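/- Let $\gamma_1,\gamma_2,\gamma_3>0$, $\Gamma=\mathrm{diag}(\gamma_1,\gamma_1,\gamma_1+\gamma_2+\gamma_3)$, and on $\mathfrak{gl}(3,\mathbb C)$ put $\langle A,B\rangle=\mathrm{Re}\,\mathrm{Tr}(A^*B)$ and $\langle\!\langle A,B\rangle\!\rangle=\mathrm{Re}\,\mathrm{Tr}(\Gamma A^*B)$. For $\mathbf w\in\mathbb R^3$ let $\hat{\mathbf w}$ be the matrix of $\mathbf v\mapsto\mathbf w\times\mathbf v$; this identifies $\mathfrak{so}(3)$, and by the dot product also $\mathfrak{so}(3)^*$, with $\mathbb R^3$. Let $$A_0=\begin{pmatrix}0&0&0\\0&0&0\\1&i&0\end{pmatrix},\qquad \mathrm{Orb}(A_0)=\{RA_0R^{-1}: R\in SO(3)\}.$$ Let $SO(3)$ act on $\mathfrak{gl}(3,\mathbb C)$ by conjugation, and identify the dual of the Lie algebra of $SO(3)\ltimes\mathfrak{gl}(3,\mathbb C)$ with $\mathbb R^3\times\mathfrak{gl}(3,\mathbb C)$ through the dot product and $\langle\cdot,\cdot\rangle$. Then the coadjoint orbit through $(\mathbf 0,A_0)$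 is $\mathcal O=\mathfrak{so}(3)^*\times\mathrm{Orb}(A_0)$. It has dimension six, and the Lie–Poisson bracket $$\{f,g\}(\mathbf m,A)=\mathbf m\cdot\Big(\frac{\delta f}{\delta\mathbf m}\times\frac{\delta g}{\delta\mathbf m}\Big)+\Big\langle\frac{\delta g}{\delta A},\Big[A,\widehat{\tfrac{\delta f}{\delta\mathbf m}}\Big]\Big\rangle-\Big\langle\frac{\delta f}{\delta A},\Big[A,\widehat{\tfrac{\delta g}{\delta\mathbf m}}\Big]\Big\rangle$$ is non-degenerate on it. For every $A\in\mathrm{Orb}(A_0)$ the matrix $\mathbf J(A)$ with entries $J_{ab}(A)=\langle\!\langle[A,\hat{\mathbf e}_a],[A,\hat{\mathbf e}_b]\rangle\!\rangle$ is invertible. Consider on $\mathcal O$ the three smooth functions $$h(\mathbf m,A)=\tfrac14\,\mathbf m^{\top}\mathbf J(A)^{-1}\mathbf m,\qquad j_m(\mathbf m,A)=2\,\langle\!\langle[\hat{\mathbf w},A],\,iA\rangle\!\rangle\ \text{ with }\ \mathbf w=\tfrac12\mathbf J(A)^{-1}\mathbf m,\qquad J_3(\mathbf m,A)=\mathbf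 e_3\cdot\mathbf m .$$ The function $j_m$ is the momentum map of the $U(1)$-action $(\mathbf m,A)\mapsto(\mathbf m,e^{i\varphi}A)$: the action preserves $\mathcal O$, and the Hamiltonian vector field of $j_m$, i.e. the derivation $f\mapsto\{f,j_m\}$, is its infinitesimal generator $(\mathbf 0,iA)$. **Theorem 4.7.** The functions $h,j_m,J_3$ form a completely integrable system on the six-dimensional coadjoint orbit $\mathcal O$: at every point of $\mathcal O$ one has $\{h,j_m\}=\{h,J_3\}=\{j_m,J_3\}=0$, and the differentials of $h,j_m,J_3$ on $\mathcal O$ are linearly independent at every point of a relatively open dense subset of $\mathcal O$ whose complement in $\mathcal O$ has six-dimensional measure zero. -/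

import Mathlib

open scoped Matrix ContDiff MeasureTheory

noncomputable section

namespace APhase

/-- Complex `3 × 3` matrices `𝔤𝔩(3, ℂ)`. -/
abbrev Gl3 : Type := Matrix (Fin 3) (Fin 3) ℂ

/-- `ℝ³ × 𝔤𝔩(3, ℂ)`, a matrix being given by its array of entries. It plays two roles: the Lie
algebra `𝔰 = 𝔰𝔬(3) ⋉ 𝔤𝔩(3, ℂ)` with elements `(ξ, V)`, and, through `pairing`, its dual `𝔰*` with
elements `(m, A)`. The sup norm that this type carries is used only for topology, smoothness and
null sets, which do not depend on the choice of a norm. -/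
abbrev Phase : Type := (Fin 3 → ℝ) × (Fin 3 → Fin 3 → ℂ)

/-- The vector component of an element of `ℝ³ × 𝔤𝔩(3, ℂ)`. -/
abbrev vec (p : Phase) : Fin 3 → ℝ := p.1

/-- The matrix component of an element of `ℝ³ × 𝔤𝔩(3, ℂ)`. -/
def mat (p : Phase) : Gl3 := Matrix.of p.2

/-- The element `(m, A)` of `ℝ³ × 𝔤𝔩(3, ℂ)`. -/
def mk (m : Fin 3 → ℝ) (A : Gl3) : Phase := (m, Matrix.of.symm A)

/-- The group `SO(3)`. -/
abbrev SO3 : Type := Matrix.specialOrthogonalGroup (Fin 3) ℝ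

/-- A rotation as a complex matrix. -/
def toC (R : SO3) : Gl3 := (R : Matrix (Fin 3) (Fin 3) ℝ).map Complex.ofReal

/-- The action `A ↦ R A R⁻¹` of `SO(3)` on `𝔤𝔩(3, ℂ)` (recall `R⁻¹ = Rᵀ`). -/
def conjBy (R : SO3) (A : Gl3) : Gl3 := toC R * A * (toC R)ᵀ

/-- The hat map: `hat w` is the skew-symmetric matrix of `v ↦ w × v`. -/
def hat (w : Fin 3 → ℝ) : Gl3 :=
  !![0, -(w 2 : ℂ), (w 1 : ℂ);
     (w 2 : ℂ), 0, -(w 0 : ℂ);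
     -(w 1 : ℂ), (w 0 : ℂ), 0]

/-- The commutator `[A, B]` of matrices. -/
def comm (A B : Gl3) : Gl3 := A * B - B * A

/-- The `k`-th standard basis vector of `ℝ³`. -/
def stdVec (k : Fin 3) : Fin 3 → ℝ := Pi.single k 1

/-- The real inner product `⟨A, B⟩ = Re Tr (A* B)`. -/
def inner₀ (A B : Gl3) : ℝ := (Matrix.trace (Aᴴ * B)).re

/-- `Γ = diag(γ₁, γ₁, γ₁ + γ₂ + γ₃)`. -/
def Gam (γ₁ γ₂ γ₃ : ℝ) : Gl3 :=
  Matrix.diagonal ![(γ₁ : ℂ), (γ₁ : ℂ), ((γ₁ + γ₂ + γ₃ : ℝ) : ℂ)]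

/-- The weighted inner product `⟪A, B⟫ = Re Tr (Γ A* B)`. -/
def innerΓ (γ₁ γ₂ γ₃ : ℝ) (A B : Gl3) : ℝ :=
  (Matrix.trace (Gam γ₁ γ₂ γ₃ * Aᴴ * B)).re

/-! The coadjoint orbits of `S = SO(3) ⋉ 𝔤𝔩(3, ℂ)`. -/

/-- The duality pairing between `𝔰*` and `𝔰`. -/
def pairing (p X : Phase) : ℝ := vec p ⬝ᵥ vec X + inner₀ (mat p) (mat X)

/-- The adjoint action `Ad_{(R, V)} (ξ, W) = (R ξ, R W R⁻¹ - [(R ξ)^, V])` of the semidirect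
product group, whose multiplication is `(R, V) (R', V') = (R R', V + R V' R⁻¹)`. -/
def adjointAction (R : SO3) (V : Gl3) (X : Phase) : Phase :=
  mk ((R : Matrix (Fin 3) (Fin 3) ℝ) *ᵥ vec X)
    (conjBy R (mat X) - comm (hat ((R : Matrix (Fin 3) (Fin 3) ℝ) *ᵥ vec X)) V)

/-- The coadjoint orbit through `p`: all `q = Ad*_{(R, V)⁻¹} p`, i.e. `p = Ad*_{(R, V)} q`. -/
def coadjointOrbit (p : Phase) : Set Phase :=
  {q | ∃ (R : SO3) (V : Gl3), ∀ X : Phase, pairing q (adjointAction R V X) = pairing p X}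

/-- The order parameter `A₀`. -/
def A₀ : Gl3 := !![0, 0, 0; 0, 0, 0; 1, Complex.I, 0]

/-- `Orb(A₀) = {R A₀ R⁻¹ | R ∈ SO(3)}`. -/
def orbA₀ : Set Gl3 := Set.range fun R : SO3 => conjBy R A₀

/-! Calculus on `𝔰*` and its orbits. Functions on an orbit are given as functions on `𝔰*` that
are smooth near the orbit. -/

/-- The functional derivative `δf/δm ∈ ℝ³` at `p`. -/
def gradM (f : Phase → ℝ) (p : Phase) : Fin 3 → ℝ :=
  fun k => fderiv ℝ f p (mk (stdVec k) 0)

/-- The derivative of `f` at `p` in the `A`-direction `B`, i.e. `⟨δf/δA, B⟩`. -/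
def derivA (f : Phase → ℝ) (p : Phase) (B : Gl3) : ℝ := fderiv ℝ f p (mk 0 B)

/-- The Lie–Poisson bracket
`{f, g}(m, A) = m · (δf/δm × δg/δm) + ⟨δg/δA, [A, (δf/δm)^]⟩ - ⟨δf/δA, [A, (δg/δm)^]⟩`. -/
def bracket (f g : Phase → ℝ) (p : Phase) : ℝ :=
  vec p ⬝ᵥ crossProduct (gradM f p) (gradM g p)
    + derivA g p (comm (mat p) (hat (gradM f p)))
    - derivA f p (comm (mat p) (hat (gradM g p)))

/-- The tangent space at `p` of a submanifold `O`: the span of the velocities at `p` of the smooth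
curves in `O` through `p`. -/
def tangentTo (O : Set Phase) (p : Phase) : Submodule ℝ Phase :=
  Submodule.span ℝ {v | ∃ c : ℝ → Phase,
    ContDiff ℝ ∞ c ∧ (∀ t, c t ∈ O) ∧ c 0 = p ∧ HasDerivAt c v 0}

/-- The differential at `p` of the restriction of `f` to `O`, a linear form on the tangent
space of `O`. -/
def diffOn (O : Set Phase) (f : Phase → ℝ) (p : Phase) : tangentTo O p →ₗ[ℝ] ℝ :=
  (fderiv ℝ f p).toLinearMap.domRestrict (tangentTo O p)

/-- `f₁, …, fₙ` form a completely integrable system on `O` with respect to the bracket: `O` has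
dimension `2n` and the bracket is non-degenerate on it, the functions are smooth, they are in
involution, and their differentials on `O` are linearly independent on a relatively open dense
subset of `O` whose complement has measure zero (for the `2n`-dimensional measure). -/
structure IsCompletelyIntegrableOn (O : Set Phase) (n : ℕ) (f : Fin n → Phase → ℝ) : Prop where
  finrank_tangent : ∀ p ∈ O, Module.finrank ℝ (tangentTo O p) = 2 * n
  nondegenerate : ∀ p ∈ O, ∀ φ : Phase →L[ℝ] ℝ,
    (∀ ψ : Phase →L[ℝ] ℝ, bracket φ ψ p = 0) → ∀ v ∈ tangentTo O p, φ v = 0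
  smooth : ∀ i, ∀ p ∈ O, ContDiffAt ℝ ∞ (f i) p
  involution : ∀ i j, ∀ p ∈ O, bracket (f i) (f j) p = 0
  independent : ∃ W : Set Phase, IsOpen W ∧ O ⊆ closure (O ∩ W) ∧
    MeasureTheory.Measure.hausdorffMeasure (2 * n : ℝ) (O \ W) = 0 ∧
    ∀ p ∈ O ∩ W, LinearIndependent ℝ fun i => diffOn O (f i) p

/-! The three functions. -/

/-- `J(A)_{ab} = ⟪[A, ê_a], [A, ê_b]⟫`. -/
def inertia (γ₁ γ₂ γ₃ : ℝ) (A : Gl3) : Matrix (Fin 3) (Fin 3) ℝ :=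
  Matrix.of fun a b => innerΓ γ₁ γ₂ γ₃ (comm A (hat (stdVec a))) (comm A (hat (stdVec b)))

/-- The velocity `w = ½ J(A)⁻¹ m`, i.e. the solution of `m = 2 J(A) w`. -/
def velocity (γ₁ γ₂ γ₃ : ℝ) (p : Phase) : Fin 3 → ℝ :=
  (1 / 2 : ℝ) • ((inertia γ₁ γ₂ γ₃ (mat p))⁻¹ *ᵥ vec p)

/-- The Hamiltonian `h(m, A) = ¼ mᵀ J(A)⁻¹ m`. -/
def hamiltonian (γ₁ γ₂ γ₃ : ℝ) (p : Phase) : ℝ :=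
  1 / 4 * (vec p ⬝ᵥ ((inertia γ₁ γ₂ γ₃ (mat p))⁻¹ *ᵥ vec p))

/-- The momentum map `j_m = 2 ⟨∂_z A Γ, iA⟩ = 2 ⟪∂_z A, iA⟫` of the circle action
`A ↦ e^{iφ} A`, with `∂_z A = [ŵ, A]` and `w = ½ J(A)⁻¹ m`. -/
def jm (γ₁ γ₂ γ₃ : ℝ) (p : Phase) : ℝ :=
  2 * innerΓ γ₁ γ₂ γ₃ (comm (hat (velocity γ₁ γ₂ γ₃ p)) (mat p)) (Complex.I • mat p)

/-- `J₃(m, A) = e₃ · m`. -/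
def J3 (p : Phase) : ℝ := stdVec 2 ⬝ᵥ vec p

end APhase

end

open APhase

noncomputable section

namespace APhase

/-! ### Rotations, the hat map and conjugation -/

/-! Since `A₀ = e₃ (e₁ + i e₂)ᵀ`, one has `R A₀ R⁻¹ = n (u + i v)ᵀ` with `u, v, n` the columns of
`R`. The orbit is thus a copy of `ℝ³ × SO(3)`, and everything can be computed from `m` and `R`. The
basic fact is that `w ↦ [A, ŵ]` is injective for `A` in the orbit (`commHat_injective`): it gives
the invertibility of `J(A)`, the dimension six, the non-degeneracy of the bracket, and the freedom
to shift `m` arbitrarily within the coadjoint orbit.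

A phase change is a rotation about the director, `iA = [A, n̂]`. Hence `j_m = -n · m` on the orbit
(`jm_eq`), and `j_m` generates the circle action (`bracket_jm`). Likewise `J₃` generates, up to
sign, the rotations about `e₃` (`bracket_J3_left`). Involution is then invariance: `J(A)` ignores
phases, `h` is invariant under rotations about `e₃` because `Γ` commutes with them, and `J₃` depends
on `m` alone.

For independence, the directions `(μ, 0)` are tangent to the orbit, and the `m`-gradients of `h,
j_m, J₃` are `w, -n, e₃`. So it suffices that `det (w, n, e₃) ≠ 0`, an open condition. It is dense:
perturb `w`, after tilting `n` if `n = ± e₃`. Where it fails, either `n = ± e₃` or `w` lies in the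
span of `n` and `e₃`; both cases are covered by `C¹` images of `ℝ⁵`, whose Hausdorff dimension is at
most five. -/

lemma SO3.mul_transpose (R : SO3) :
    (R : Matrix (Fin 3) (Fin 3) ℝ) * (R : Matrix (Fin 3) (Fin 3) ℝ)ᵀ = 1 := by
  have h := (Matrix.mem_specialOrthogonalGroup_iff.mp R.2).1
  rw [Matrix.mem_orthogonalGroup_iff] at h
  exact h

lemma SO3.transpose_mul (R : SO3) :
    (R : Matrix (Fin 3) (Fin 3) ℝ)ᵀ * (R : Matrix (Fin 3) (Fin 3) ℝ) = 1 :=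
  mul_eq_one_comm.mp R.mul_transpose

lemma SO3.det_eq_one (R : SO3) : (R : Matrix (Fin 3) (Fin 3) ℝ).det = 1 :=
  (Matrix.mem_specialOrthogonalGroup_iff.mp R.2).2

lemma mem_SO3 {Q : Matrix (Fin 3) (Fin 3) ℝ} (h : Q * Qᵀ = 1) (hd : Q.det = 1) :
    Q ∈ Matrix.specialOrthogonalGroup (Fin 3) ℝ :=
  Matrix.mem_specialOrthogonalGroup_iff.mpr ⟨(Matrix.mem_orthogonalGroup_iff _ _).mpr h, hd⟩

/-- The inverse rotation. -/
def SO3.symm (R : SO3) : SO3 :=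
  ⟨(R : Matrix (Fin 3) (Fin 3) ℝ)ᵀ, mem_SO3 (by simpa using R.transpose_mul)
    (by rw [Matrix.det_transpose]; exact R.det_eq_one)⟩

lemma SO3.adjugate_eq (R : SO3) :
    (R : Matrix (Fin 3) (Fin 3) ℝ).adjugate = (R : Matrix (Fin 3) (Fin 3) ℝ)ᵀ := by
  have h := Matrix.adjugate_mul (R : Matrix (Fin 3) (Fin 3) ℝ)
  rw [R.det_eq_one, one_smul] at h
  calc _ = (R : Matrix (Fin 3) (Fin 3) ℝ).adjugate * (R.1 * R.1ᵀ) := by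
        rw [R.mul_transpose, mul_one]
    _ = _ := by rw [← mul_assoc, h, one_mul]

/-- The cofactors of a rotation are its entries. -/
lemma SO3.cofactors (R : SO3) :
    (R.1 0 0 = R.1 1 1 * R.1 2 2 - R.1 1 2 * R.1 2 1 ∧
      R.1 0 1 = R.1 1 2 * R.1 2 0 - R.1 1 0 * R.1 2 2 ∧
      R.1 0 2 = R.1 1 0 * R.1 2 1 - R.1 1 1 * R.1 2 0) ∧
    (R.1 1 0 = R.1 0 2 * R.1 2 1 - R.1 0 1 * R.1 2 2 ∧
      R.1 1 1 = R.1 0 0 * R.1 2 2 - R.1 0 2 * R.1 2 0 ∧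
      R.1 1 2 = R.1 0 1 * R.1 2 0 - R.1 0 0 * R.1 2 1) ∧
    (R.1 2 0 = R.1 0 1 * R.1 1 2 - R.1 0 2 * R.1 1 1 ∧
      R.1 2 1 = R.1 0 2 * R.1 1 0 - R.1 0 0 * R.1 1 2 ∧
      R.1 2 2 = R.1 0 0 * R.1 1 1 - R.1 0 1 * R.1 1 0) := by
  have h := R.adjugate_eq
  rw [Matrix.adjugate_fin_three] at h
  have e := fun i j => congrFun (congrFun h i) j
  refine ⟨⟨?_, ?_, ?_⟩, ⟨?_, ?_, ?_⟩, ?_, ?_, ?_⟩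
  · have := e 0 0; simp at this; linarith
  · have := e 1 0; simp at this; linarith
  · have := e 2 0; simp at this; linarith
  · have := e 0 1; simp at this; linarith
  · have := e 1 1; simp at this; linarith
  · have := e 2 1; simp at this; linarith
  · have := e 0 2; simp at this; linarith
  · have := e 1 2; simp at this; linarith
  · have := e 2 2; simp at this; linarith

lemma SO3.rows (R : SO3) (i j : Fin 3) :
    R.1 i 0 * R.1 j 0 + R.1 i 1 * R.1 j 1 + R.1 i 2 * R.1 j 2 = if i = j then 1 else 0 := by
  have := congrFun (congrFun R.mul_transpose i) j
  simpa [Matrix.mul_apply, Fin.sum_univ_three, Matrix.one_apply] using this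

lemma SO3.cols (R : SO3) (i j : Fin 3) :
    R.1 0 i * R.1 0 j + R.1 1 i * R.1 1 j + R.1 2 i * R.1 2 j = if i = j then 1 else 0 := by
  have := congrFun (congrFun R.transpose_mul i) j
  simpa [Matrix.mul_apply, Fin.sum_univ_three, Matrix.one_apply] using this

/-- The hat map with real entries. -/
def hatR (w : Fin 3 → ℝ) : Matrix (Fin 3) (Fin 3) ℝ :=
  !![0, -w 2, w 1; w 2, 0, -w 0; -w 1, w 0, 0]

lemma hat_eq_map (w : Fin 3 → ℝ) : hat w = (hatR w).map Complex.ofReal := by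
  ext i j; fin_cases i <;> fin_cases j <;> simp [hat, hatR]

lemma hat_add (w x : Fin 3 → ℝ) : hat (w + x) = hat w + hat x := by
  ext i j; fin_cases i <;> fin_cases j <;> simp [hat] <;> ring

lemma hat_smul (r : ℝ) (w : Fin 3 → ℝ) : hat (r • w) = r • hat w := by
  ext i j; fin_cases i <;> fin_cases j <;> simp [hat]

lemma hat_zero : hat 0 = 0 := by simpa using hat_smul 0 0

/-- Rotations preserve the cross product; in coordinates this is linear in the cofactor identities,
where `det R = 1` enters. -/
lemma hatR_mul (R : SO3) (w : Fin 3 → ℝ) : hatR (R.1 *ᵥ w) * R.1 = R.1 * hatR w := by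
  obtain ⟨⟨h1, h2, h3⟩, ⟨h4, h5, h6⟩, h7, h8, h9⟩ := R.cofactors
  ext i j
  fin_cases i <;> fin_cases j <;>
    simp [hatR, Matrix.mul_apply, Fin.sum_univ_three, Matrix.mulVec, dotProduct]
  · linear_combination w 1 * h3 - w 2 * h2
  · linear_combination w 2 * h1 - w 0 * h3
  · linear_combination w 0 * h2 - w 1 * h1
  · linear_combination w 1 * h6 - w 2 * h5
  · linear_combination w 2 * h4 - w 0 * h6
  · linear_combination w 0 * h5 - w 1 * h4
  · linear_combination w 1 * h9 - w 2 * h8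
  · linear_combination w 2 * h7 - w 0 * h9
  · linear_combination w 0 * h8 - w 1 * h7

lemma toC_mul_coe (R : SO3) (M : Matrix (Fin 3) (Fin 3) ℝ) :
    toC R * M.map Complex.ofReal = (R.1 * M).map Complex.ofReal := by
  simp only [toC]
  exact (map_mul (RingHom.mapMatrix Complex.ofRealHom) R.1 M).symm

lemma coe_mul_toC (R : SO3) (M : Matrix (Fin 3) (Fin 3) ℝ) :
    M.map Complex.ofReal * toC R = (M * R.1).map Complex.ofReal := by
  simp only [toC]
  exact (map_mul (RingHom.mapMatrix Complex.ofRealHom) M R.1).symm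

lemma toC_mul (Q R : SO3) : toC (Q * R) = toC Q * toC R :=
  (toC_mul_coe Q R.1).symm

lemma toC_symm (R : SO3) : toC R.symm = (toC R)ᵀ := by
  ext i j; simp [toC, SO3.symm]

lemma toC_conjTranspose (R : SO3) : (toC R)ᴴ = (toC R)ᵀ := by
  ext i j; simp [toC]

lemma toC_mul_transpose (R : SO3) : toC R * (toC R)ᵀ = 1 := by
  rw [← toC_symm, toC, toC, SO3.symm]
  rw [← toC, toC_mul_coe, R.mul_transpose]
  simp

lemma toC_transpose_mul (R : SO3) : (toC R)ᵀ * toC R = 1 :=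
  mul_eq_one_comm.mp (toC_mul_transpose R)

lemma conjBy_conjBy (Q R : SO3) (A : Gl3) : conjBy Q (conjBy R A) = conjBy (Q * R) A := by
  simp only [conjBy, toC_mul, Matrix.transpose_mul, mul_assoc]

lemma conjBy_symm_conjBy (R : SO3) (A : Gl3) : conjBy R.symm (conjBy R A) = A := by
  simp only [conjBy, toC_symm, Matrix.transpose_transpose]
  calc _ = ((toC R)ᵀ * toC R) * A * ((toC R)ᵀ * toC R) := by simp only [mul_assoc]
    _ = A := by rw [toC_transpose_mul, one_mul, mul_one]

lemma conjBy_conjBy_symm (R : SO3) (A : Gl3) : conjBy R (conjBy R.symm A) = A := by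
  have h := conjBy_symm_conjBy R.symm A
  have e : R.symm.symm = R := Subtype.ext (Matrix.transpose_transpose _)
  rwa [e] at h

lemma conjBy_mul (R : SO3) (A B : Gl3) : conjBy R (A * B) = conjBy R A * conjBy R B := by
  simp only [conjBy]
  calc _ = toC R * A * 1 * B * (toC R)ᵀ := by simp only [mul_one, mul_assoc]
    _ = _ := by rw [← toC_transpose_mul R]; simp only [mul_assoc]

lemma conjBy_sub (R : SO3) (A B : Gl3) : conjBy R (A - B) = conjBy R A - conjBy R B := by
  simp only [conjBy, mul_sub, sub_mul]

lemma conjBy_smul (R : SO3) (c : ℂ) (A : Gl3) : conjBy R (c • A) = c • conjBy R A := by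
  simp [conjBy]

lemma conjBy_comm (R : SO3) (A B : Gl3) :
    conjBy R (comm A B) = comm (conjBy R A) (conjBy R B) := by
  simp only [comm, conjBy_sub, conjBy_mul]

lemma conjBy_hat (R : SO3) (w : Fin 3 → ℝ) : conjBy R (hat w) = hat (R.1 *ᵥ w) := by
  have h : toC R * hat w = hat (R.1 *ᵥ w) * toC R := by
    rw [hat_eq_map, hat_eq_map, toC_mul_coe, coe_mul_toC, hatR_mul]
  rw [conjBy, h, mul_assoc, toC_mul_transpose, mul_one]

lemma mulVec_symm_mulVec (R : SO3) (w : Fin 3 → ℝ) : R.1 *ᵥ (R.symm.1 *ᵥ w) = w := by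
  rw [Matrix.mulVec_mulVec, show R.1 * R.symm.1 = 1 from R.mul_transpose, Matrix.one_mulVec]

lemma comm_conjBy_hat (R : SO3) (A : Gl3) (w : Fin 3 → ℝ) :
    comm (conjBy R A) (hat (R.1 *ᵥ w)) = conjBy R (comm A (hat w)) := by
  rw [conjBy_comm, conjBy_hat]

lemma comm_swap (A B : Gl3) : comm A B = -comm B A := by
  simp [comm]

/-- `w ↦ [A, ŵ]` as a linear map. -/
def commHat (A : Gl3) : (Fin 3 → ℝ) →ₗ[ℝ] Gl3 where
  toFun w := comm A (hat w)
  map_add' w x := by simp only [comm, hat_add, mul_add, add_mul]; abel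
  map_smul' r w := by
    simp only [comm, hat_smul, Matrix.mul_smul, Matrix.smul_mul, smul_sub, RingHom.id_apply]

lemma comm_hat_neg (A : Gl3) (w : Fin 3 → ℝ) : comm A (hat (-w)) = -comm A (hat w) :=
  map_neg (commHat A) w

lemma comm_hat_left (A : Gl3) (w : Fin 3 → ℝ) : comm (hat w) A = comm A (hat (-w)) := by
  rw [comm_hat_neg, comm_swap]

lemma comm_hat_expand (A : Gl3) (w : Fin 3 → ℝ) :
    comm A (hat w) = w 0 • comm A (hat (stdVec 0)) + w 1 • comm A (hat (stdVec 1))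
      + w 2 • comm A (hat (stdVec 2)) := by
  have e : w = w 0 • stdVec 0 + w 1 • stdVec 1 + w 2 • stdVec 2 := by
    ext i; fin_cases i <;> simp [stdVec]
  conv_lhs => rw [e]
  change commHat A _ = _
  simp only [map_add, map_smul]
  rfl

/-! ### The order parameter manifold -/

/-- The rank-one form `n (u + i v)ᵀ`, in terms of the columns of `R`. -/
lemma conjBy_A₀_apply (R : SO3) (j k : Fin 3) :
    conjBy R A₀ j k = R.1 j 2 * (R.1 k 0 + Complex.I * R.1 k 1) := by
  simp [conjBy, A₀, toC, Matrix.mul_apply, Fin.sum_univ_three]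
  ring

lemma commHat_A₀_injective (w : Fin 3 → ℝ) (h : comm A₀ (hat w) = 0) : w = 0 := by
  have e := fun i j => congrFun (congrFun h i) j
  have e0 := e 0 0
  have e1 := e 1 0
  have e2 := e 2 0
  simp [comm, A₀, hat, Complex.ext_iff] at e0 e1 e2
  ext i; fin_cases i <;> simp_all

lemma commHat_injective {A : Gl3} (hA : A ∈ orbA₀) {w : Fin 3 → ℝ}
    (h : comm A (hat w) = 0) : w = 0 := by
  obtain ⟨R, rfl⟩ := hA
  simp only at h
  rw [← mulVec_symm_mulVec R w, comm_conjBy_hat] at h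
  have h' := congrArg (conjBy R.symm) h
  rw [conjBy_symm_conjBy] at h'
  have := commHat_A₀_injective _ (by simpa [conjBy] using h')
  rw [← mulVec_symm_mulVec R w, this, Matrix.mulVec_zero]

/-- The director `n = R e₃` of `R A₀ R⁻¹`. -/
def director (R : SO3) : Fin 3 → ℝ := fun i => R.1 i 2

/-- Infinitesimal form of the fact that a phase is a rotation about the director. By equivariance it
only has to be checked at `A₀`, where the director is `e₃`. -/
lemma I_smul_conjBy_A₀ (R : SO3) :
    Complex.I • conjBy R A₀ = comm (conjBy R A₀) (hat (director R)) := by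
  have e : director R = R.1 *ᵥ stdVec 2 := by
    ext i; simp [director, stdVec]
  rw [e, comm_conjBy_hat, ← conjBy_smul]
  congr 1
  ext i j
  fin_cases i <;> fin_cases j <;>
    simp [comm, A₀, hat, stdVec]

/-- The rotation by the angle `t` about the third axis. -/
def rotZ (t : ℝ) : SO3 :=
  ⟨!![Real.cos t, -Real.sin t, 0; Real.sin t, Real.cos t, 0; 0, 0, 1], mem_SO3
    (by
      have := Real.sin_sq_add_cos_sq t
      ext i j
      fin_cases i <;> fin_cases j <;>
        simp [Matrix.mul_apply, Fin.sum_univ_three] <;> nlinarith)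
    (by
      have := Real.sin_sq_add_cos_sq t
      simp [Matrix.det_fin_three]; nlinarith)⟩

/-- The vector `e₁ + i e₂` is an eigenvector of the rotations about `e₃`, which fix the other factor
`e₃` of `A₀`. -/
lemma exp_smul_A₀ (t : ℝ) : Complex.exp (t * Complex.I) • A₀ = conjBy (rotZ (-t)) A₀ := by
  ext i j
  rw [conjBy_A₀_apply, Complex.exp_mul_I]
  fin_cases i <;> fin_cases j <;> simp [A₀, rotZ]
  · ring
  · linear_combination (Complex.sin t) * Complex.I_sq

lemma exp_smul_mem_orbA₀ (t : ℝ) {A : Gl3} (hA : A ∈ orbA₀) :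
    Complex.exp (t * Complex.I) • A ∈ orbA₀ := by
  obtain ⟨R, rfl⟩ := hA
  exact ⟨R * rotZ (-t), by simp only [← conjBy_conjBy, ← exp_smul_A₀, conjBy_smul]⟩

/-! ### The inner products and the tensor of inertia -/

section Inertia

variable (γ₁ γ₂ γ₃ : ℝ)

lemma innerΓ_apply (A B : Gl3) : innerΓ γ₁ γ₂ γ₃ A B =
    ∑ k, ![γ₁, γ₁, γ₁ + γ₂ + γ₃] k *
      ∑ j, ((A j k).re * (B j k).re + (A j k).im * (B j k).im) := by
  simp [innerΓ, Gam, Matrix.trace, Matrix.mul_apply, Fin.sum_univ_three, Matrix.diagonal]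
  ring

/-- Lets the results on the weighted product and on `inertia` serve for `⟨·,·⟩`; this is why
positivity below is only asked as `0 ≤ γ₂` and `0 ≤ γ₃`. -/
lemma inner₀_eq_innerΓ (A B : Gl3) : inner₀ A B = innerΓ 1 0 0 A B := by
  have : Gam 1 0 0 = 1 := by
    ext i j; fin_cases i <;> fin_cases j <;> simp [Gam]
  rw [innerΓ, this, one_mul, inner₀]

lemma innerΓ_symm (A B : Gl3) : innerΓ γ₁ γ₂ γ₃ A B = innerΓ γ₁ γ₂ γ₃ B A := by
  simp only [innerΓ_apply, mul_comm]

lemma innerΓ_add_right (A B C : Gl3) :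
    innerΓ γ₁ γ₂ γ₃ A (B + C) = innerΓ γ₁ γ₂ γ₃ A B + innerΓ γ₁ γ₂ γ₃ A C := by
  simp [innerΓ, mul_add]

lemma innerΓ_smul_right (r : ℝ) (A B : Gl3) :
    innerΓ γ₁ γ₂ γ₃ A (r • B) = r * innerΓ γ₁ γ₂ γ₃ A B := by
  simp [innerΓ]

lemma innerΓ_add_left (A B C : Gl3) :
    innerΓ γ₁ γ₂ γ₃ (A + B) C = innerΓ γ₁ γ₂ γ₃ A C + innerΓ γ₁ γ₂ γ₃ B C := by
  rw [innerΓ_symm, innerΓ_add_right, innerΓ_symm _ _ _ C, innerΓ_symm _ _ _ C]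

lemma innerΓ_smul_left (r : ℝ) (A B : Gl3) :
    innerΓ γ₁ γ₂ γ₃ (r • A) B = r * innerΓ γ₁ γ₂ γ₃ A B := by
  rw [innerΓ_symm, innerΓ_smul_right, innerΓ_symm]

lemma innerΓ_neg_left (A B : Gl3) : innerΓ γ₁ γ₂ γ₃ (-A) B = -innerΓ γ₁ γ₂ γ₃ A B := by
  simpa using innerΓ_smul_left γ₁ γ₂ γ₃ (-1) A B

lemma innerΓ_smul_smul (c : ℂ) (hc : star c * c = 1) (A B : Gl3) :
    innerΓ γ₁ γ₂ γ₃ (c • A) (c • B) = innerΓ γ₁ γ₂ γ₃ A B := by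
  simp only [innerΓ, Matrix.conjTranspose_smul, Matrix.mul_smul, Matrix.smul_mul, smul_smul]
  rw [mul_comm, hc, one_smul]

lemma innerΓ_conjBy (Q : SO3) (hQ : Gam γ₁ γ₂ γ₃ * toC Q = toC Q * Gam γ₁ γ₂ γ₃) (A B : Gl3) :
    innerΓ γ₁ γ₂ γ₃ (conjBy Q A) (conjBy Q B) = innerΓ γ₁ γ₂ γ₃ A B := by
  have e : Gam γ₁ γ₂ γ₃ * (conjBy Q A)ᴴ * conjBy Q B =
      toC Q * (Gam γ₁ γ₂ γ₃ * Aᴴ * B * (toC Q)ᵀ) := by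
    have h1 : (conjBy Q A)ᴴ = toC Q * Aᴴ * (toC Q)ᵀ := by
      rw [conjBy, Matrix.conjTranspose_mul, Matrix.conjTranspose_mul, toC_conjTranspose,
        ← toC_symm, toC_conjTranspose, toC_symm, Matrix.transpose_transpose, mul_assoc]
    rw [h1, conjBy]
    calc _ = (Gam γ₁ γ₂ γ₃ * toC Q) * Aᴴ * ((toC Q)ᵀ * toC Q) * B * (toC Q)ᵀ := by
          simp only [mul_assoc]
      _ = _ := by rw [hQ, toC_transpose_mul, mul_one]; simp only [mul_assoc]
  rw [innerΓ, e, Matrix.trace_mul_comm, mul_assoc, toC_transpose_mul, mul_one, innerΓ]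

variable {γ₁ γ₂ γ₃} in
lemma innerΓ_self_eq_zero (h1 : 0 < γ₁) (h2 : 0 ≤ γ₂) (h3 : 0 ≤ γ₃) {A : Gl3}
    (h : innerΓ γ₁ γ₂ γ₃ A A = 0) : A = 0 := by
  rw [innerΓ_apply] at h
  have pos : ∀ k, 0 < ![γ₁, γ₁, γ₁ + γ₂ + γ₃] k := by
    intro k; fin_cases k <;> simp <;> linarith
  have nn : ∀ j k, 0 ≤ (A j k).re * (A j k).re + (A j k).im * (A j k).im := fun j k =>
    add_nonneg (mul_self_nonneg _) (mul_self_nonneg _)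
  rw [Finset.sum_eq_zero_iff_of_nonneg
    (fun k _ => mul_nonneg (pos k).le (Finset.sum_nonneg fun j _ => nn j k))] at h
  ext j k
  have hk := (mul_eq_zero.mp (h k (Finset.mem_univ _))).resolve_left (pos k).ne'
  rw [Finset.sum_eq_zero_iff_of_nonneg (fun j _ => nn j k)] at hk
  have := hk j (Finset.mem_univ _)
  have a := mul_self_nonneg (A j k).re
  have b := mul_self_nonneg (A j k).im
  exact Complex.ext (mul_self_eq_zero.mp (by linarith)) (mul_self_eq_zero.mp (by linarith))

lemma dotProduct_inertia_mulVec (A : Gl3) (w x : Fin 3 → ℝ) :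
    w ⬝ᵥ inertia γ₁ γ₂ γ₃ A *ᵥ x =
      innerΓ γ₁ γ₂ γ₃ (comm A (hat w)) (comm A (hat x)) := by
  rw [comm_hat_expand A w, comm_hat_expand A x]
  simp only [innerΓ_add_left, innerΓ_add_right, innerΓ_smul_left, innerΓ_smul_right]
  simp [dotProduct, Matrix.mulVec, Fin.sum_univ_three, inertia]
  ring

lemma inertia_transpose (A : Gl3) : (inertia γ₁ γ₂ γ₃ A)ᵀ = inertia γ₁ γ₂ γ₃ A := by
  ext a b
  simp [inertia, innerΓ_symm γ₁ γ₂ γ₃ (comm A (hat (stdVec b)))]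

variable {γ₁ γ₂ γ₃} in
-- `J(A)` is the Gram matrix of the vectors `[A, ê_a]`, so a kernel vector `w` would give `⟪[A, ŵ],
-- [A, ŵ]⟫ = 0`.
lemma isUnit_det_inertia (h1 : 0 < γ₁) (h2 : 0 ≤ γ₂) (h3 : 0 ≤ γ₃) {A : Gl3}
    (hA : A ∈ orbA₀) : IsUnit (inertia γ₁ γ₂ γ₃ A).det := by
  rw [isUnit_iff_ne_zero]
  intro h
  obtain ⟨w, hw, h0⟩ := Matrix.exists_mulVec_eq_zero_iff.mpr h
  have e := dotProduct_inertia_mulVec γ₁ γ₂ γ₃ A w w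
  rw [h0, dotProduct_zero] at e
  exact hw (commHat_injective hA (innerΓ_self_eq_zero h1 h2 h3 e.symm))

lemma inertia_smul (c : ℂ) (hc : star c * c = 1) (A : Gl3) :
    inertia γ₁ γ₂ γ₃ (c • A) = inertia γ₁ γ₂ γ₃ A := by
  ext a b
  have e : ∀ B, comm (c • A) B = c • comm A B := fun B => by
    simp [comm, smul_sub]
  simp only [inertia, Matrix.of_apply, e, innerΓ_smul_smul _ _ _ c hc]

lemma inertia_conjBy (Q : SO3) (hQ : Gam γ₁ γ₂ γ₃ * toC Q = toC Q * Gam γ₁ γ₂ γ₃) (A : Gl3) :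
    inertia γ₁ γ₂ γ₃ (conjBy Q A) = Q.1 * inertia γ₁ γ₂ γ₃ A * Q.1ᵀ := by
  have key : ∀ w x, w ⬝ᵥ inertia γ₁ γ₂ γ₃ (conjBy Q A) *ᵥ x =
      w ⬝ᵥ (Q.1 * inertia γ₁ γ₂ γ₃ A * Q.1ᵀ) *ᵥ x := by
    intro w x
    have e : ∀ y, comm (conjBy Q A) (hat y) = conjBy Q (comm A (hat (Q.1ᵀ *ᵥ y))) := by
      intro y
      rw [← comm_conjBy_hat]
      exact congrArg (fun z => comm (conjBy Q A) (hat z)) (mulVec_symm_mulVec Q y).symm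
    rw [dotProduct_inertia_mulVec, e, e, innerΓ_conjBy γ₁ γ₂ γ₃ Q hQ,
      ← dotProduct_inertia_mulVec, ← Matrix.mulVec_mulVec, ← Matrix.mulVec_mulVec,
      Matrix.dotProduct_mulVec w Q.1, ← Matrix.mulVec_transpose]
  ext a b
  simpa using key (Pi.single a 1) (Pi.single b 1)

end Inertia

/-! ### The coadjoint orbit -/

@[simp] lemma mat_mk (m : Fin 3 → ℝ) (A : Gl3) : mat (mk m A) = A := rfl

lemma vec_mk (m : Fin 3 → ℝ) (A : Gl3) : vec (mk m A) = m := rfl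

lemma mk_vec_mat (p : Phase) : mk (vec p) (mat p) = p := rfl

lemma inner₀_conjBy (R : SO3) (A B : Gl3) : inner₀ (conjBy R A) (conjBy R B) = inner₀ A B := by
  rw [inner₀_eq_innerΓ, inner₀_eq_innerΓ, innerΓ_conjBy]
  have : Gam 1 0 0 = 1 := by
    ext i j; fin_cases i <;> fin_cases j <;> simp [Gam]
  rw [this, one_mul, mul_one]

/-- `ŵ` is real and skew, hence skew-Hermitian, and the trace is cyclic. -/
lemma inner₀_comm_hat (A B : Gl3) (w : Fin 3 → ℝ) :
    inner₀ A (comm (hat w) B) = inner₀ (comm A (hat w)) B := by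
  have h : (hat w)ᴴ = -hat w := by
    ext i j; fin_cases i <;> fin_cases j <;> simp [hat]
  simp only [inner₀, comm, Matrix.conjTranspose_sub, Matrix.conjTranspose_mul, h]
  congr 1
  simp only [mul_sub, sub_mul, Matrix.trace_sub, neg_mul, mul_neg, Matrix.trace_neg]
  rw [← mul_assoc, ← mul_assoc, Matrix.trace_mul_comm (Aᴴ * B), mul_assoc (hat w)]
  ring

lemma inner₀_sub_right (A B C : Gl3) : inner₀ A (B - C) = inner₀ A B - inner₀ A C := by
  simp [inner₀, mul_sub]

lemma inner₀_sub_left (A B C : Gl3) : inner₀ (A - B) C = inner₀ A C - inner₀ B C := by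
  simp [inner₀, sub_mul]

lemma coadjointOrbit_eq : coadjointOrbit (mk 0 A₀) = {p | mat p ∈ orbA₀} := by
  ext q
  constructor
  · rintro ⟨R, V, h⟩
    refine ⟨R, ?_⟩
    have e : ∀ W, inner₀ (conjBy R A₀ - mat q) W = 0 := by
      intro W
      -- Testing against elements with zero rotational part removes `V` and determines the matrix
      -- part.
      have hW := h (mk 0 (conjBy R.symm W))
      simp only [pairing, adjointAction, vec_mk, mat_mk, Matrix.mulVec_zero, hat_zero, comm,
        zero_mul, mul_zero, sub_zero, dotProduct_zero, zero_add, conjBy_conjBy_symm] at hW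
      rw [inner₀_sub_left, hW, ← inner₀_conjBy R A₀, conjBy_conjBy_symm, sub_self]
    have e' := e (conjBy R A₀ - mat q)
    rw [inner₀_eq_innerΓ] at e'
    exact sub_eq_zero.mp (innerΓ_self_eq_zero one_pos le_rfl le_rfl e')
  · intro hq
    have hu := isUnit_det_inertia one_pos le_rfl le_rfl hq
    obtain ⟨R, hR⟩ := hq
    simp only at hR
    -- `V = [A, x̂]` contributes `-⟨[A, (R ξ)^], [A, x̂]⟩ = -(R ξ) · J x` for the unweighted `J`;
    -- solving `J x = m` makes it cancel `m · R ξ`.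
    set x := (inertia 1 0 0 (mat q))⁻¹ *ᵥ vec q with hx
    refine ⟨R, comm (mat q) (hat x), fun X => ?_⟩
    have hJ : inertia 1 0 0 (mat q) *ᵥ x = vec q := by
      rw [hx, Matrix.mulVec_mulVec, Matrix.mul_nonsing_inv _ hu, Matrix.one_mulVec]
    simp only [pairing, adjointAction, vec_mk, mat_mk, zero_dotProduct, zero_add]
    rw [inner₀_sub_right, inner₀_comm_hat, inner₀_eq_innerΓ (comm _ _),
      ← dotProduct_inertia_mulVec, hJ, dotProduct_comm, ← hR, inner₀_conjBy]
    ring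

/-! ### Curves of rotations and tangent spaces -/

/-- A rational curve of rotations through `1` with velocity `ŵ` (Cayley transform of `t ŵ / 2`). -/
def spinMatrix (w : Fin 3 → ℝ) (t : ℝ) : Matrix (Fin 3) (Fin 3) ℝ :=
  Matrix.of fun i j => (1 + (w 0 ^ 2 + w 1 ^ 2 + w 2 ^ 2) / 4 * t ^ 2)⁻¹ *
    ((1 : Matrix (Fin 3) (Fin 3) ℝ) i j + hatR w i j * t +
      (w i * w j / 2 - (w 0 ^ 2 + w 1 ^ 2 + w 2 ^ 2) / 4 * (1 : Matrix (Fin 3) (Fin 3) ℝ) i j)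
        * t ^ 2)

lemma spin_denominator_pos (w : Fin 3 → ℝ) (t : ℝ) :
    0 < 1 + (w 0 ^ 2 + w 1 ^ 2 + w 2 ^ 2) / 4 * t ^ 2 := by positivity

/-- `spinMatrix` as a curve in `SO(3)`. -/
def spin (w : Fin 3 → ℝ) (t : ℝ) : SO3 :=
  ⟨spinMatrix w t, mem_SO3
    (by
      have h := (spin_denominator_pos w t).ne'
      ext i j
      fin_cases i <;> fin_cases j <;>
        simp [Matrix.mul_apply, Fin.sum_univ_three, spinMatrix, hatR] <;> field_simp <;> ring)
    (by
      have h := (spin_denominator_pos w t).ne'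
      simp [Matrix.det_fin_three, spinMatrix, hatR]; field_simp; ring)⟩

lemma spin_zero (w : Fin 3 → ℝ) : spin w 0 = 1 := by
  ext i j
  simp [spin, spinMatrix]

lemma contDiff_spin (w : Fin 3 → ℝ) (i j : Fin 3) : ContDiff ℝ ∞ fun t => (spin w t).1 i j := by
  simp only [spin, spinMatrix, Matrix.of_apply]
  refine ContDiff.mul (ContDiff.inv (by fun_prop) fun t => (spin_denominator_pos w t).ne') ?_
  fun_prop

lemma hasDerivAt_spin (w : Fin 3 → ℝ) (i j : Fin 3) :
    HasDerivAt (fun t => (spin w t).1 i j) (hatR w i j) 0 := by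
  simp only [spin, spinMatrix, Matrix.of_apply]
  generalize (w 0 ^ 2 + w 1 ^ 2 + w 2 ^ 2) / 4 = k
  generalize hatR w i j = b
  generalize (1 : Matrix (Fin 3) (Fin 3) ℝ) i j = a
  generalize w i * w j / 2 - k * a = c
  have h1 : HasDerivAt (fun t : ℝ => 1 + k * t ^ 2) 0 0 := by
    have := (((hasDerivAt_id (0 : ℝ)).pow 2).const_mul k).const_add 1
    simpa using this
  have h2 : HasDerivAt (fun t : ℝ => a + b * t + c * t ^ 2) b 0 := by
    have := ((((hasDerivAt_id (0 : ℝ)).const_mul b).const_add a).add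
      (((hasDerivAt_id (0 : ℝ)).pow 2).const_mul c))
    exact this.congr_deriv (by simp)
  have := (h1.inv (by simp)).mul h2
  exact this.congr_deriv (by simp)

lemma hatR_transpose (w : Fin 3 → ℝ) (i j : Fin 3) : hatR w i j = -hatR w j i := by
  fin_cases i <;> fin_cases j <;> simp [hatR]

/-- Product rule: the derivative is `ŵ A + A ŵᵀ`, and `ŵᵀ = -ŵ`. -/
lemma hasDerivAt_conjBy_A₀ {R : ℝ → SO3} {w : Fin 3 → ℝ}
    (hR : ∀ i j, HasDerivAt (fun t => (R t).1 i j) ((hatR w * (R 0).1) i j) 0) (j k : Fin 3) :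
    HasDerivAt (fun t => conjBy (R t) A₀ j k) (comm (hat w) (conjBy (R 0) A₀) j k) 0 := by
  simp only [conjBy_A₀_apply]
  have h := (hR j 2).ofReal_comp.mul
    ((hR k 0).ofReal_comp.add ((hR k 1).ofReal_comp.const_mul Complex.I))
  refine h.congr_deriv ?_
  simp only [comm, hat_eq_map, Matrix.sub_apply, Matrix.mul_apply, Fin.sum_univ_three,
    conjBy_A₀_apply, Matrix.map_apply, Pi.add_apply]
  rw [hatR_transpose w 0 k, hatR_transpose w 1 k, hatR_transpose w 2 k]
  push_cast
  ring

lemma hasDerivAt_phase {c : ℝ → Phase} {t : ℝ} {μ : Fin 3 → ℝ} {B : Gl3}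
    (h1 : ∀ i, HasDerivAt (fun s => vec (c s) i) (μ i) t)
    (h2 : ∀ j k, HasDerivAt (fun s => mat (c s) j k) (B j k) t) :
    HasDerivAt c (mk μ B) t :=
  (hasDerivAt_pi.mpr h1).prodMk
    (hasDerivAt_pi.mpr fun j => hasDerivAt_pi.mpr fun k => h2 j k)

lemma HasDerivAt.mat_apply {c : ℝ → Phase} {v : Phase} {t : ℝ} (h : HasDerivAt c v t)
    (j k : Fin 3) : HasDerivAt (fun s => mat (c s) j k) (mat v j k) t :=
  hasDerivAt_pi.mp (hasDerivAt_pi.mp h.snd j) k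

/-- The curve `t ↦ (m + t μ, Q_t R A₀ R⁻¹ Q_t⁻¹)` with `Q_t = spin w t`. -/
def orbitCurve (m μ w : Fin 3 → ℝ) (R : SO3) (t : ℝ) : Phase :=
  mk (m + t • μ) (conjBy (spin w t * R) A₀)

lemma orbitCurve_zero (m μ w : Fin 3 → ℝ) (R : SO3) :
    orbitCurve m μ w R 0 = mk m (conjBy R A₀) := by
  simp [orbitCurve, spin_zero]

lemma hasDerivAt_spin_mul (w : Fin 3 → ℝ) (R : SO3) (i j : Fin 3) :
    HasDerivAt (fun t => (spin w t * R).1 i j) ((hatR w * R.1) i j) 0 := by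
  have h : ∀ t, (spin w t * R).1 i j = (spin w t).1 i 0 * R.1 0 j + (spin w t).1 i 1 * R.1 1 j
      + (spin w t).1 i 2 * R.1 2 j := fun t => by
    change ((spin w t).1 * R.1) i j = _
    rw [Matrix.mul_apply, Fin.sum_univ_three]
  simp only [h, Matrix.mul_apply, Fin.sum_univ_three]
  exact (((hasDerivAt_spin w i 0).mul_const _).add ((hasDerivAt_spin w i 1).mul_const _)).add
    ((hasDerivAt_spin w i 2).mul_const _)

lemma contDiff_SO3_mul {E : Type*} [NormedAddCommGroup E] [NormedSpace ℝ E] {n : WithTop ℕ∞}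
    {Q R : E → SO3} (hQ : ∀ i j, ContDiff ℝ n fun t => (Q t).1 i j)
    (hR : ∀ i j, ContDiff ℝ n fun t => (R t).1 i j) (i j : Fin 3) :
    ContDiff ℝ n fun t => (Q t * R t).1 i j := by
  have h : ∀ t, (Q t * R t).1 i j = ∑ l, (Q t).1 i l * (R t).1 l j := fun t => by
    change ((Q t).1 * (R t).1) i j = _
    rw [Matrix.mul_apply]
  simp only [h]
  exact ContDiff.sum fun l _ => (hQ i l).mul (hR l j)

lemma contDiff_conjBy_A₀ {E : Type*} [NormedAddCommGroup E] [NormedSpace ℝ E] {n : WithTop ℕ∞}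
    {R : E → SO3} (h : ∀ i j, ContDiff ℝ n fun t => (R t).1 i j) (j k : Fin 3) :
    ContDiff ℝ n fun t => conjBy (R t) A₀ j k := by
  simp only [conjBy_A₀_apply]
  have h' : ∀ i j, ContDiff ℝ n fun t => (((R t).1 i j : ℝ) : ℂ) := fun i j =>
    Complex.ofRealCLM.contDiff.comp (h i j)
  exact (h' j 2).mul ((h' k 0).add (contDiff_const.mul (h' k 1)))

lemma contDiff_phase {E : Type*} [NormedAddCommGroup E] [NormedSpace ℝ E] {n : WithTop ℕ∞}
    {c : E → Phase} (h1 : ∀ i, ContDiff ℝ n fun s => vec (c s) i)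
    (h2 : ∀ j k, ContDiff ℝ n fun s => mat (c s) j k) : ContDiff ℝ n c :=
  (contDiff_pi.mpr h1).prodMk (contDiff_pi.mpr fun j => contDiff_pi.mpr fun k => h2 j k)

lemma contDiff_orbitCurve (m μ w : Fin 3 → ℝ) (R : SO3) :
    ContDiff ℝ ∞ (orbitCurve m μ w R) := by
  refine contDiff_phase (fun i => ?_) (contDiff_conjBy_A₀
    (contDiff_SO3_mul (contDiff_spin w) fun _ _ => contDiff_const))
  change ContDiff ℝ ∞ fun s : ℝ => m i + s * μ i
  fun_prop

lemma hasDerivAt_orbitCurve (m μ w : Fin 3 → ℝ) (R : SO3) :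
    HasDerivAt (orbitCurve m μ w R) (mk μ (comm (hat w) (conjBy R A₀))) 0 := by
  refine hasDerivAt_phase (fun i => ?_) fun j k => ?_
  · change HasDerivAt (fun s : ℝ => m i + s * μ i) (μ i) 0
    simpa using ((hasDerivAt_id (0 : ℝ)).mul_const (μ i)).const_add (m i)
  · have h := hasDerivAt_conjBy_A₀ (R := fun t => spin w t * R) (w := w)
      (by simpa [spin_zero] using hasDerivAt_spin_mul w R) j k
    simp only [spin_zero, one_mul] at h
    exact h

lemma mem_orbit_iff {p : Phase} : p ∈ coadjointOrbit (mk 0 A₀) ↔ mat p ∈ orbA₀ := by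
  rw [coadjointOrbit_eq]; rfl

lemma mk_mem_orbit (m : Fin 3 → ℝ) (R : SO3) :
    mk m (conjBy R A₀) ∈ coadjointOrbit (mk 0 A₀) :=
  mem_orbit_iff.mpr ⟨R, rfl⟩

lemma exists_eq_mk_conjBy {p : Phase} (hp : p ∈ coadjointOrbit (mk 0 A₀)) :
    ∃ (m : Fin 3 → ℝ) (R : SO3), p = mk m (conjBy R A₀) := by
  obtain ⟨R, hR⟩ := mem_orbit_iff.mp hp
  refine ⟨vec p, R, ?_⟩
  simp only at hR
  rw [hR, mk_vec_mat]

/-- The frame `(u, v, n)` of a matrix `n (u + i v)ᵀ`, as a polynomial in its entries. -/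
def frame (A : Gl3) : Matrix (Fin 3) (Fin 3) ℝ :=
  let u := ![-(A 1 2 - A 2 1).im, -(A 2 0 - A 0 2).im, -(A 0 1 - A 1 0).im]
  let v := ![(A 1 2 - A 2 1).re, (A 2 0 - A 0 2).re, (A 0 1 - A 1 0).re]
  let n := ![u 1 * v 2 - u 2 * v 1, u 2 * v 0 - u 0 * v 2, u 0 * v 1 - u 1 * v 0]
  Matrix.of fun i j => ![u i, v i, n i] j

/-- The antisymmetric part of `n (u + i v)ᵀ` encodes `n × (u + i v) = v - i u`, and `n = u × v`. So
`R` is a polynomial function of `A`, which lets curves in the orbit be lifted differentiably to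
`SO(3)`. -/
lemma frame_conjBy_A₀ (R : SO3) : frame (conjBy R A₀) = R.1 := by
  obtain ⟨⟨h1, h2, h3⟩, ⟨h4, h5, h6⟩, h7, h8, h9⟩ := R.cofactors
  have hu : ∀ i, frame (conjBy R A₀) i 0 = R.1 i 0 := by
    intro i
    fin_cases i <;> simp [frame, conjBy_A₀_apply] <;> linarith
  have hv : ∀ i, frame (conjBy R A₀) i 1 = R.1 i 1 := by
    intro i
    fin_cases i <;> simp [frame, conjBy_A₀_apply] <;> linarith
  have hn : ∀ i, frame (conjBy R A₀) i 2 =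
      ![frame (conjBy R A₀) 1 0 * frame (conjBy R A₀) 2 1
        - frame (conjBy R A₀) 2 0 * frame (conjBy R A₀) 1 1,
        frame (conjBy R A₀) 2 0 * frame (conjBy R A₀) 0 1
        - frame (conjBy R A₀) 0 0 * frame (conjBy R A₀) 2 1,
        frame (conjBy R A₀) 0 0 * frame (conjBy R A₀) 1 1
        - frame (conjBy R A₀) 1 0 * frame (conjBy R A₀) 0 1] i := by
    intro i
    fin_cases i <;> simp [frame]
  ext i j
  fin_cases j
  · exact hu i
  · exact hv i
  · change frame _ i 2 = R.1 i 2
    rw [hn]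
    simp only [hu, hv]
    fin_cases i <;> simp <;> linarith

lemma contDiff_frame (i j : Fin 3) : ContDiff ℝ ∞ fun p : Phase => frame (mat p) i j := by
  have hm : ∀ j k, ContDiff ℝ ∞ fun p : Phase => mat p j k := fun j k => by
    simp only [mat, Matrix.of_apply]; fun_prop
  have hr : ∀ j k, ContDiff ℝ ∞ fun p : Phase => (mat p j k).re := fun j k =>
    Complex.reCLM.contDiff.comp (hm j k)
  have hi : ∀ j k, ContDiff ℝ ∞ fun p : Phase => (mat p j k).im := fun j k =>
    Complex.imCLM.contDiff.comp (hm j k)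
  fin_cases i <;> fin_cases j <;> simp [frame] <;> fun_prop

lemma exists_hatR_of_skew {M : Matrix (Fin 3) (Fin 3) ℝ} (h : M + Mᵀ = 0) :
    ∃ w, M = hatR w := by
  have e : ∀ i j, M i j + M j i = 0 := fun i j => by
    simpa using congrFun (congrFun h i) j
  refine ⟨![M 2 1, M 0 2, M 1 0], ?_⟩
  have e00 := e 0 0
  have e11 := e 1 1
  have e22 := e 2 2
  have e01 := e 0 1
  have e02 := e 0 2
  have e12 := e 1 2
  ext i j
  fin_cases i <;> fin_cases j <;> simp [hatR] <;> linarith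

/-- The parametrization `(μ, w) ↦ (μ, [ŵ, A])` of the tangent space. -/
def tangentMap (A : Gl3) : (Fin 3 → ℝ) × (Fin 3 → ℝ) →ₗ[ℝ] Phase where
  toFun x := mk x.1 (comm (hat x.2) A)
  map_add' x y := by
    rw [comm_swap, comm_swap _ A, comm_swap _ A]
    refine Prod.ext rfl ?_
    change Matrix.of.symm (-(commHat A (x.2 + y.2))) = _
    rw [map_add, neg_add]; rfl
  map_smul' r x := by
    rw [comm_swap, comm_swap _ A]
    refine Prod.ext rfl ?_
    change Matrix.of.symm (-(commHat A (r • x.2))) = _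
    rw [map_smul, ← smul_neg]; rfl

lemma exists_angular_velocity {c : ℝ → Phase} {v : Phase}
    (hO : ∀ t, c t ∈ coadjointOrbit (mk 0 A₀)) (hv : HasDerivAt c v 0) :
    ∃ w, mat v = comm (hat w) (mat (c 0)) := by
  choose m R hR using fun t => exists_eq_mk_conjBy (hO t)
  have hfr : ∀ t, frame (mat (c t)) = (R t).1 := fun t => by
    rw [hR t, mat_mk, frame_conjBy_A₀]
  have hd : ∀ i j, HasDerivAt (fun t => (R t).1 i j)
      (fderiv ℝ (fun p : Phase => frame (mat p) i j) (c 0) v) 0 := by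
    intro i j
    have hf := ((contDiff_frame i j).differentiable (by simp) (c 0)).hasFDerivAt
    have := hf.comp_hasDerivAt (0 : ℝ) hv
    simpa only [Function.comp_def, hfr] using this
  set R' : Matrix (Fin 3) (Fin 3) ℝ :=
    Matrix.of fun i j => fderiv ℝ (fun p : Phase => frame (mat p) i j) (c 0) v with hR'
  have hd : ∀ i j, HasDerivAt (fun t => (R t).1 i j) (R' i j) 0 := hd
  -- Differentiate the constant `R Rᵀ = 1`.
  have hskew : R' * (R 0).1ᵀ + (R' * (R 0).1ᵀ)ᵀ = 0 := by
    ext i j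
    have h0 : HasDerivAt (fun t => (R t).1 i 0 * (R t).1 j 0 + (R t).1 i 1 * (R t).1 j 1
        + (R t).1 i 2 * (R t).1 j 2) 0 0 := by
      simp only [SO3.rows]; exact hasDerivAt_const _ _
    have h1 := (((hd i 0).mul (hd j 0)).add ((hd i 1).mul (hd j 1))).add ((hd i 2).mul (hd j 2))
    have := h1.unique h0
    simp [Matrix.mul_apply, Fin.sum_univ_three]
    linarith
  obtain ⟨w, hw⟩ := exists_hatR_of_skew hskew
  have hR'w : R' = hatR w * (R 0).1 := by
    rw [← hw, mul_assoc, SO3.transpose_mul, mul_one]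
  refine ⟨w, ?_⟩
  ext j k
  have h1 := hasDerivAt_conjBy_A₀ (R := R) (w := w) (by rw [← hR'w]; exact hd) j k
  have h2 := HasDerivAt.mat_apply hv j k
  have e : ∀ t, mat (c t) = conjBy (R t) A₀ := fun t => by rw [hR t, mat_mk]
  simp only [e] at h2 ⊢
  exact h2.unique h1

lemma tangentTo_orbit {p : Phase} (hp : p ∈ coadjointOrbit (mk 0 A₀)) :
    tangentTo (coadjointOrbit (mk 0 A₀)) p = LinearMap.range (tangentMap (mat p)) := by
  apply le_antisymm
  · refine Submodule.span_le.mpr ?_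
    rintro v ⟨c, -, hO, rfl, hv⟩
    obtain ⟨w, hw⟩ := exists_angular_velocity hO hv
    exact ⟨(vec v, w), by simp only [tangentMap, LinearMap.coe_mk, AddHom.coe_mk, ← hw]; rfl⟩
  · obtain ⟨m, R, rfl⟩ := exists_eq_mk_conjBy hp
    rintro _ ⟨⟨μ, w⟩, rfl⟩
    exact Submodule.subset_span ⟨orbitCurve m μ w R, contDiff_orbitCurve m μ w R,
      fun t => mk_mem_orbit _ _, orbitCurve_zero m μ w R, hasDerivAt_orbitCurve m μ w R⟩

lemma finrank_tangentTo_orbit {p : Phase} (hp : p ∈ coadjointOrbit (mk 0 A₀)) :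
    Module.finrank ℝ (tangentTo (coadjointOrbit (mk 0 A₀)) p) = 6 := by
  rw [tangentTo_orbit hp, LinearMap.finrank_range_of_inj]
  · simp
  · rw [← LinearMap.ker_eq_bot, LinearMap.ker_eq_bot']
    rintro ⟨μ, w⟩ h
    have h1 : μ = 0 := congrArg Prod.fst h
    have h2 : comm (hat w) (mat p) = 0 := congrArg mat h
    rw [comm_swap, neg_eq_zero] at h2
    rw [h1, commHat_injective (mem_orbit_iff.mp hp) h2]
    rfl

/-! ### Smoothness -/

section Smooth

variable {E : Type*} [NormedAddCommGroup E] [NormedSpace ℝ E] {x : E} {n : WithTop ℕ∞}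

lemma contDiff_mat_apply (j k : Fin 3) : ContDiff ℝ n fun p : Phase => mat p j k := by
  simp only [mat, Matrix.of_apply]; fun_prop

lemma contDiffAt_hat {w : E → Fin 3 → ℝ} (h : ∀ i, ContDiffAt ℝ n (fun t => w t i) x)
    (j k : Fin 3) : ContDiffAt ℝ n (fun t => hat (w t) j k) x := by
  have h' : ∀ i, ContDiffAt ℝ n (fun t => ((w t i : ℝ) : ℂ)) x := fun i =>
    Complex.ofRealCLM.contDiff.contDiffAt.comp x (h i)
  fin_cases j <;> fin_cases k <;> simp [hat] <;>
    first
      | exact contDiffAt_const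
      | exact h' _
      | exact (h' _).neg

lemma contDiffAt_comm {X Y : E → Gl3} (hX : ∀ j k, ContDiffAt ℝ n (fun t => X t j k) x)
    (hY : ∀ j k, ContDiffAt ℝ n (fun t => Y t j k) x) (j k : Fin 3) :
    ContDiffAt ℝ n (fun t => comm (X t) (Y t) j k) x := by
  simp only [comm, Matrix.sub_apply, Matrix.mul_apply]
  exact (ContDiffAt.sum fun l _ => (hX j l).mul (hY l k)).sub
    (ContDiffAt.sum fun l _ => (hY j l).mul (hX l k))

lemma contDiffAt_innerΓ (γ₁ γ₂ γ₃ : ℝ) {X Y : E → Gl3}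
    (hX : ∀ j k, ContDiffAt ℝ n (fun t => X t j k) x)
    (hY : ∀ j k, ContDiffAt ℝ n (fun t => Y t j k) x) :
    ContDiffAt ℝ n (fun t => innerΓ γ₁ γ₂ γ₃ (X t) (Y t)) x := by
  simp only [innerΓ_apply]
  have re : ∀ {f : E → ℂ}, ContDiffAt ℝ n f x → ContDiffAt ℝ n (fun t => (f t).re) x :=
    fun h => Complex.reCLM.contDiff.contDiffAt.comp x h
  have im : ∀ {f : E → ℂ}, ContDiffAt ℝ n f x → ContDiffAt ℝ n (fun t => (f t).im) x :=
    fun h => Complex.imCLM.contDiff.contDiffAt.comp x h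
  exact ContDiffAt.sum fun k _ => contDiffAt_const.mul (ContDiffAt.sum fun j _ =>
    ((re (hX j k)).mul (re (hY j k))).add ((im (hX j k)).mul (im (hY j k))))

lemma contDiffAt_inertia (γ₁ γ₂ γ₃ : ℝ) {X : E → Gl3}
    (hX : ∀ j k, ContDiffAt ℝ n (fun t => X t j k) x) (a b : Fin 3) :
    ContDiffAt ℝ n (fun t => inertia γ₁ γ₂ γ₃ (X t) a b) x := by
  simp only [inertia, Matrix.of_apply]
  exact contDiffAt_innerΓ _ _ _ (contDiffAt_comm hX fun _ _ => contDiffAt_const)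
    (contDiffAt_comm hX fun _ _ => contDiffAt_const)

lemma contDiffAt_nonsing_inv {M : E → Matrix (Fin 3) (Fin 3) ℝ}
    (hM : ∀ a b, ContDiffAt ℝ n (fun t => M t a b) x) (hx : (M x).det ≠ 0) (a b : Fin 3) :
    ContDiffAt ℝ n (fun t => (M t)⁻¹ a b) x := by
  simp only [Matrix.inv_def, Ring.inverse_eq_inv', Matrix.smul_apply, smul_eq_mul]
  have hdet : ContDiffAt ℝ n (fun t => (M t).det) x := by
    simp only [Matrix.det_fin_three]
    fun_prop
  refine (hdet.inv hx).mul ?_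
  · simp only [Matrix.adjugate_fin_three]
    fin_cases a <;> fin_cases b <;> simp <;> fun_prop

variable (γ₁ γ₂ γ₃ : ℝ) {p : Phase}

lemma contDiffAt_inertia_inv_mulVec (hp : (inertia γ₁ γ₂ γ₃ (mat p)).det ≠ 0) (a : Fin 3) :
    ContDiffAt ℝ n (fun q : Phase => ((inertia γ₁ γ₂ γ₃ (mat q))⁻¹ *ᵥ vec q) a) p := by
  simp only [Matrix.mulVec, dotProduct]
  exact ContDiffAt.sum fun b _ => (contDiffAt_nonsing_inv (contDiffAt_inertia γ₁ γ₂ γ₃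
    fun j k => (contDiff_mat_apply j k).contDiffAt) hp a b).mul (by fun_prop)

lemma contDiffAt_velocity (hp : (inertia γ₁ γ₂ γ₃ (mat p)).det ≠ 0) (a : Fin 3) :
    ContDiffAt ℝ n (fun q : Phase => velocity γ₁ γ₂ γ₃ q a) p := by
  simp only [velocity, Pi.smul_apply, smul_eq_mul]
  exact contDiffAt_const.mul (contDiffAt_inertia_inv_mulVec γ₁ γ₂ γ₃ hp a)

lemma contDiffAt_hamiltonian (hp : (inertia γ₁ γ₂ γ₃ (mat p)).det ≠ 0) :
    ContDiffAt ℝ n (hamiltonian γ₁ γ₂ γ₃) p := by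
  unfold hamiltonian
  simp only [dotProduct]
  exact contDiffAt_const.mul (ContDiffAt.sum fun a _ =>
    ContDiffAt.mul (by fun_prop) (contDiffAt_inertia_inv_mulVec γ₁ γ₂ γ₃ hp a))

lemma contDiffAt_jm (hp : (inertia γ₁ γ₂ γ₃ (mat p)).det ≠ 0) :
    ContDiffAt ℝ n (jm γ₁ γ₂ γ₃) p := by
  unfold jm
  refine contDiffAt_const.mul (contDiffAt_innerΓ _ _ _ (contDiffAt_comm
    (contDiffAt_hat (contDiffAt_velocity γ₁ γ₂ γ₃ hp))
    fun j k => (contDiff_mat_apply j k).contDiffAt) fun j k => ?_)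
  exact contDiffAt_const.mul (contDiff_mat_apply j k).contDiffAt

lemma contDiff_J3 : ContDiff ℝ n J3 := by
  unfold J3
  simp only [dotProduct]
  exact ContDiff.sum fun a _ => contDiff_const.mul (by fun_prop)

end Smooth

/-! ### The Lie–Poisson bracket on the orbit -/

/-- Evaluates `fderiv` in a tangent direction from values of `f` along one curve, so formulas valid
only on the orbit suffice. -/
lemma fderiv_eq_of_curve {f : Phase → ℝ} {p v : Phase} {c : ℝ → Phase} {d : ℝ}
    (hf : DifferentiableAt ℝ f p) (h0 : c 0 = p) (hc : HasDerivAt c v 0)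
    (hfc : HasDerivAt (fun t => f (c t)) d 0) : fderiv ℝ f p v = d := by
  subst h0
  exact (hf.hasFDerivAt.comp_hasDerivAt (0 : ℝ) hc).unique hfc

lemma map_mk_zero_right (L : Phase →L[ℝ] ℝ) (μ : Fin 3 → ℝ) :
    L (mk μ 0) = (fun k => L (mk (stdVec k) 0)) ⬝ᵥ μ := by
  have e : mk μ 0 = μ 0 • mk (stdVec 0) 0 + μ 1 • mk (stdVec 1) 0 + μ 2 • mk (stdVec 2) 0 := by
    refine Prod.ext ?_ ?_
    · ext i; fin_cases i <;> simp [mk, stdVec]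
    · ext i j; simp [mk]
  rw [e]
  simp only [map_add, map_smul, dotProduct, Fin.sum_univ_three, smul_eq_mul]
  ring

lemma mk_eq_add (μ : Fin 3 → ℝ) (B : Gl3) : mk μ B = mk μ 0 + mk 0 B :=
  Prod.ext (add_zero μ).symm (zero_add (Matrix.of.symm B)).symm

/-- The cyclic triple product collects all terms in `g`'s differential into one derivative along a
vector built from `δf/δm`. -/
lemma bracket_eq (f g : Phase → ℝ) (p : Phase) : bracket f g p =
    fderiv ℝ g p (mk (crossProduct (vec p) (gradM f p)) (comm (mat p) (hat (gradM f p))))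
      - derivA f p (comm (mat p) (hat (gradM g p))) := by
  rw [mk_eq_add, map_add, map_mk_zero_right, triple_product_permutation]
  rfl

lemma bracket_swap (f g : Phase → ℝ) (p : Phase) : bracket f g p = -bracket g f p := by
  unfold bracket
  rw [← cross_anticomm, dotProduct_neg]
  ring

lemma bracket_self (f : Phase → ℝ) (p : Phase) : bracket f f p = 0 := by
  have := bracket_swap f f p
  linarith

lemma gradM_clm (φ : Phase →L[ℝ] ℝ) (p : Phase) :
    gradM φ p = fun k => φ (mk (stdVec k) 0) := by
  unfold gradM; rw [φ.fderiv]

lemma derivA_clm (φ : Phase →L[ℝ] ℝ) (p : Phase) (B : Gl3) : derivA φ p B = φ (mk 0 B) := by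
  unfold derivA; rw [φ.fderiv]

/-- The Lie–Poisson bracket is non-degenerate on the orbit. -/
lemma bracket_nondegenerate {p : Phase} (hp : p ∈ coadjointOrbit (mk 0 A₀)) (φ : Phase →L[ℝ] ℝ)
    (h : ∀ ψ : Phase →L[ℝ] ℝ, bracket φ ψ p = 0) {v : Phase}
    (hv : v ∈ tangentTo (coadjointOrbit (mk 0 A₀)) p) : φ v = 0 := by
  have hmk : mk 0 0 = (0 : Phase) := rfl
  have hgrad : gradM φ p = 0 := by
    refine commHat_injective (mem_orbit_iff.mp hp) ?_
    -- Test with `ψ` a real-linear function of one matrix entry: only the term `ψ([A, (δφ/δm)^])`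
    -- survives.
    have key : ∀ (L : ℂ →L[ℝ] ℝ) (j k : Fin 3), L (comm (mat p) (hat (gradM φ p)) j k) = 0 := by
      intro L j k
      let ψ : Phase →L[ℝ] ℝ := L.comp ((ContinuousLinearMap.proj k).comp
        ((ContinuousLinearMap.proj (R := ℝ) (φ := fun _ : Fin 3 => Fin 3 → ℂ) j).comp
          (ContinuousLinearMap.snd ℝ _ _)))
      have hψ : ∀ μ B, ψ (mk μ B) = L (B j k) := fun μ B => rfl
      have hb := h ψ
      have hg : gradM ψ p = 0 := by
        rw [gradM_clm]; ext k; simp [hψ]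
      rw [bracket, hg, hat_zero, derivA_clm, derivA_clm, hψ] at hb
      simpa [comm, hmk] using hb
    ext j k
    exact Complex.ext (key Complex.reCLM j k) (key Complex.imCLM j k)
  have hA : ∀ w, φ (mk 0 (comm (mat p) (hat w))) = 0 := by
    intro w
    -- With `δφ/δm = 0`, testing against `m ↦ w · m` isolates the derivative of `φ` along `[A, ŵ]`.
    let ψ : Phase →L[ℝ] ℝ := ∑ k, w k • (ContinuousLinearMap.proj (R := ℝ)
      (φ := fun _ : Fin 3 => ℝ) k).comp (ContinuousLinearMap.fst ℝ _ _)
    have hψ : ∀ μ B, ψ (mk μ B) = w ⬝ᵥ μ := fun μ B => by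
      simp [ψ, dotProduct, mk]
    have hg : gradM ψ p = w := by
      rw [gradM_clm]; ext k; simp [hψ, stdVec]
    have hb := h ψ
    rw [bracket, hg, hgrad, hat_zero, derivA_clm, derivA_clm, hψ] at hb
    simpa using hb
  rw [tangentTo_orbit hp] at hv
  obtain ⟨⟨μ, w⟩, rfl⟩ := hv
  change φ (mk μ (comm (hat w) (mat p))) = 0
  rw [mk_eq_add, map_add, map_mk_zero_right, ← gradM_clm φ p, hgrad, comm_hat_left, hA,
    zero_dotProduct, zero_add]

/-! ### The momentum maps and the Hamiltonian on the orbit -/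

section Functions

variable (γ₁ γ₂ γ₃ : ℝ)

lemma inertia_mulVec_velocity {p : Phase} (hu : IsUnit (inertia γ₁ γ₂ γ₃ (mat p)).det) :
    inertia γ₁ γ₂ γ₃ (mat p) *ᵥ velocity γ₁ γ₂ γ₃ p = (1 / 2 : ℝ) • vec p := by
  rw [velocity, Matrix.mulVec_smul, Matrix.mulVec_mulVec, Matrix.mul_nonsing_inv _ hu,
    Matrix.one_mulVec]

lemma velocity_of_inertia_mulVec {A : Gl3} (hu : IsUnit (inertia γ₁ γ₂ γ₃ A).det)
    (w : Fin 3 → ℝ) : velocity γ₁ γ₂ γ₃ (mk ((2 : ℝ) • inertia γ₁ γ₂ γ₃ A *ᵥ w) A) = w := by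
  rw [velocity, vec_mk, mat_mk, Matrix.mulVec_smul, Matrix.mulVec_mulVec,
    Matrix.nonsing_inv_mul _ hu, Matrix.one_mulVec, smul_smul]
  norm_num

variable {γ₁ γ₂ γ₃}

/-- Substituting `iA = [A, n̂]` turns the product into `-2 n · J w`, and `2 J w = m`. -/
lemma jm_eq (m : Fin 3 → ℝ) (R : SO3)
    (hu : IsUnit (inertia γ₁ γ₂ γ₃ (conjBy R A₀)).det) :
    jm γ₁ γ₂ γ₃ (mk m (conjBy R A₀)) = -(director R ⬝ᵥ m) := by
  rw [jm, mat_mk, I_smul_conjBy_A₀, comm_swap, innerΓ_neg_left, innerΓ_symm,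
    ← dotProduct_inertia_mulVec]
  have := inertia_mulVec_velocity γ₁ γ₂ γ₃ (p := mk m (conjBy R A₀)) hu
  rw [mat_mk] at this
  rw [this, vec_mk, dotProduct_smul, smul_eq_mul]
  ring

lemma fderiv_jm (m : Fin 3 → ℝ) (R : SO3)
    (hu : ∀ A ∈ orbA₀, IsUnit (inertia γ₁ γ₂ γ₃ A).det) (μ w : Fin 3 → ℝ) :
    fderiv ℝ (jm γ₁ γ₂ γ₃) (mk m (conjBy R A₀)) (mk μ (comm (hat w) (conjBy R A₀))) =
      -((hatR w *ᵥ director R) ⬝ᵥ m) - director R ⬝ᵥ μ := by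
  have hd : (inertia γ₁ γ₂ γ₃ (mat (mk m (conjBy R A₀)))).det ≠ 0 := (hu _ ⟨R, rfl⟩).ne_zero
  refine fderiv_eq_of_curve ((contDiffAt_jm (n := 1) γ₁ γ₂ γ₃ hd).differentiableAt (by simp))
    (orbitCurve_zero m μ w R) (hasDerivAt_orbitCurve m μ w R) ?_
  have e : ∀ t, jm γ₁ γ₂ γ₃ (orbitCurve m μ w R t) =
      -((spin w t * R).1 0 2 * (m 0 + t * μ 0) + (spin w t * R).1 1 2 * (m 1 + t * μ 1)
        + (spin w t * R).1 2 2 * (m 2 + t * μ 2)) := fun t => by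
    rw [orbitCurve, jm_eq _ _ (hu _ ⟨_, rfl⟩)]
    simp [director, dotProduct, Fin.sum_univ_three]
  simp only [e]
  have hl : ∀ i, HasDerivAt (fun t : ℝ => m i + t * μ i) (μ i) 0 := fun i => by
    simpa using ((hasDerivAt_id (0 : ℝ)).mul_const (μ i)).const_add (m i)
  have hs := fun i => (hasDerivAt_spin_mul w R i 2).mul (hl i)
  refine (((hs 0).add (hs 1)).add (hs 2)).neg.congr_deriv ?_
  simp [spin_zero, Matrix.mul_apply, dotProduct, Matrix.mulVec, Fin.sum_univ_three, director]
  ring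

lemma gradM_jm (m : Fin 3 → ℝ) (R : SO3)
    (hu : ∀ A ∈ orbA₀, IsUnit (inertia γ₁ γ₂ γ₃ A).det) :
    gradM (jm γ₁ γ₂ γ₃) (mk m (conjBy R A₀)) = -director R := by
  ext k
  have h := fderiv_jm m R hu (stdVec k) 0
  have e : comm (hat 0) (conjBy R A₀) = 0 := by simp [comm, hat_zero]
  have e' : hatR 0 = 0 := by ext i j; fin_cases i <;> fin_cases j <;> simp [hatR]
  rw [e, e', Matrix.zero_mulVec, zero_dotProduct] at h
  rw [gradM, h]
  simp [stdVec]

/-- `jm` generates the circle action: `{f, jm}` is the derivative of `f` along `(0, iA)`. -/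
lemma bracket_jm {p : Phase} (hp : p ∈ coadjointOrbit (mk 0 A₀))
    (hu : ∀ A ∈ orbA₀, IsUnit (inertia γ₁ γ₂ γ₃ A).det) (f : Phase → ℝ) :
    bracket f (jm γ₁ γ₂ γ₃) p = fderiv ℝ f p (mk 0 (Complex.I • mat p)) := by
  obtain ⟨m, R, rfl⟩ := exists_eq_mk_conjBy hp
  rw [bracket_eq, gradM_jm m R hu]
  generalize gradM f (mk m (conjBy R A₀)) = a
  have e : comm (conjBy R A₀) (hat a) = comm (hat (-a)) (conjBy R A₀) := by
    rw [comm_hat_left, neg_neg]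
  have hmk : ∀ B, mk 0 (-B) = -mk 0 B := fun B => Prod.ext neg_zero.symm rfl
  rw [vec_mk, mat_mk, e, fderiv_jm m R hu, comm_hat_neg, ← I_smul_conjBy_A₀, derivA, hmk, map_neg]
  -- The derivative of `-n · m` under a simultaneous rotation of `n` and `m` vanishes; only the
  -- `A`-derivative of `f` remains.
  have z : -((hatR (-a) *ᵥ director R) ⬝ᵥ m) - director R ⬝ᵥ crossProduct m a = 0 := by
    simp [hatR, dotProduct, Matrix.mulVec, Fin.sum_univ_three, cross_apply]
    ring
  rw [z]
  ring

lemma fderiv_J3 (p v : Phase) : fderiv ℝ J3 p v = vec v 2 := by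
  have e : J3 = ((ContinuousLinearMap.proj (R := ℝ) (φ := fun _ : Fin 3 => ℝ) 2).comp
      (ContinuousLinearMap.fst ℝ (Fin 3 → ℝ) (Fin 3 → Fin 3 → ℂ)) : Phase →L[ℝ] ℝ) := by
    ext q; simp [J3, stdVec]
  rw [e, ContinuousLinearMap.fderiv]
  rfl

lemma gradM_J3 (p : Phase) : gradM J3 p = stdVec 2 := by
  ext k
  rw [gradM, fderiv_J3, vec_mk]
  fin_cases k <;> simp [stdVec]

lemma bracket_J3_left (g : Phase → ℝ) (p : Phase) : bracket J3 g p =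
    fderiv ℝ g p (mk (crossProduct (vec p) (stdVec 2)) (comm (mat p) (hat (stdVec 2)))) := by
  rw [bracket_eq, gradM_J3, derivA, fderiv_J3, vec_mk]
  simp

lemma differentiableAt_hamiltonian {p : Phase} (hu : IsUnit (inertia γ₁ γ₂ γ₃ (mat p)).det) :
    DifferentiableAt ℝ (hamiltonian γ₁ γ₂ γ₃) p :=
  (contDiffAt_hamiltonian (n := 1) γ₁ γ₂ γ₃ hu.ne_zero).differentiableAt (by simp)

lemma hamiltonian_phase (t : ℝ) (m : Fin 3 → ℝ) (A : Gl3) :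
    hamiltonian γ₁ γ₂ γ₃ (mk m (Complex.exp (t * Complex.I) • A)) =
      hamiltonian γ₁ γ₂ γ₃ (mk m A) := by
  have hc : star (Complex.exp (t * Complex.I)) * Complex.exp (t * Complex.I) = 1 := by
    rw [Complex.star_def, ← Complex.normSq_eq_conj_mul_self, Complex.normSq_eq_norm_sq,
      Complex.norm_exp_ofReal_mul_I]
    simp
  simp only [hamiltonian, mat_mk, vec_mk, inertia_smul _ _ _ _ hc]

lemma hasDerivAt_phase_rotation (m : Fin 3 → ℝ) (A : Gl3) :
    HasDerivAt (fun t : ℝ => mk m (Complex.exp (t * Complex.I) • A)) (mk 0 (Complex.I • A)) 0 := by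
  have h : HasDerivAt (fun t : ℝ => Complex.exp (t * Complex.I)) Complex.I 0 := by
    have := ((hasDerivAt_id (0 : ℝ)).ofReal_comp.mul_const Complex.I).cexp
    simpa using this
  exact hasDerivAt_phase (fun i => hasDerivAt_const _ _) fun j k => h.mul_const (A j k)

lemma bracket_hamiltonian_jm {p : Phase} (hp : p ∈ coadjointOrbit (mk 0 A₀))
    (hu : ∀ A ∈ orbA₀, IsUnit (inertia γ₁ γ₂ γ₃ A).det) :
    bracket (hamiltonian γ₁ γ₂ γ₃) (jm γ₁ γ₂ γ₃) p = 0 := by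
  rw [bracket_jm hp hu]
  refine fderiv_eq_of_curve (differentiableAt_hamiltonian (hu _ (mem_orbit_iff.mp hp)))
    (by simp [mk_vec_mat]) (hasDerivAt_phase_rotation (vec p) (mat p)) ?_
  simp only [hamiltonian_phase]
  exact hasDerivAt_const _ _

/-- For `Q` commuting with `Γ`, `J(Q A Q⁻¹) = Q J(A) Qᵀ`, so the rotations cancel in the quadratic
form. -/
lemma hamiltonian_conjBy (Q : SO3) (hQ : Gam γ₁ γ₂ γ₃ * toC Q = toC Q * Gam γ₁ γ₂ γ₃)
    (m : Fin 3 → ℝ) (A : Gl3) :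
    hamiltonian γ₁ γ₂ γ₃ (mk (Q.1 *ᵥ m) (conjBy Q A)) = hamiltonian γ₁ γ₂ γ₃ (mk m A) := by
  have hi : (Q.1)⁻¹ = Q.1ᵀ := Matrix.inv_eq_right_inv Q.mul_transpose
  have hi' : (Q.1ᵀ)⁻¹ = Q.1 := Matrix.inv_eq_right_inv Q.transpose_mul
  simp only [hamiltonian, mat_mk, vec_mk]
  rw [inertia_conjBy _ _ _ Q hQ, Matrix.mul_inv_rev, Matrix.mul_inv_rev, hi, hi',
    Matrix.mulVec_mulVec, mul_assoc, mul_assoc, Q.transpose_mul, mul_one,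
    Matrix.dotProduct_mulVec, ← Matrix.vecMul_vecMul, Matrix.vecMul_mulVec, Q.transpose_mul,
    Matrix.vecMul_one, ← Matrix.dotProduct_mulVec]

lemma Gam_comm_spin (r t : ℝ) : Gam γ₁ γ₂ γ₃ * toC (spin (r • stdVec 2) t) =
    toC (spin (r • stdVec 2) t) * Gam γ₁ γ₂ γ₃ := by
  ext i j
  fin_cases i <;> fin_cases j <;>
    simp [Gam, toC, spin, spinMatrix, hatR, stdVec] <;> ring

lemma hasDerivAt_spin_mulVec (w m : Fin 3 → ℝ) (i : Fin 3) :
    HasDerivAt (fun t => ((spin w t).1 *ᵥ m) i) ((hatR w *ᵥ m) i) 0 := by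
  simp only [Matrix.mulVec, dotProduct, Fin.sum_univ_three]
  exact (((hasDerivAt_spin w i 0).mul_const _).add ((hasDerivAt_spin w i 1).mul_const _)).add
    ((hasDerivAt_spin w i 2).mul_const _)

lemma bracket_J3_hamiltonian {p : Phase} (hp : p ∈ coadjointOrbit (mk 0 A₀))
    (hu : ∀ A ∈ orbA₀, IsUnit (inertia γ₁ γ₂ γ₃ A).det) :
    bracket J3 (hamiltonian γ₁ γ₂ γ₃) p = 0 := by
  rw [bracket_J3_left]
  have hup := hu _ (mem_orbit_iff.mp hp)
  obtain ⟨m, R, rfl⟩ := exists_eq_mk_conjBy hp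
  -- The sign comes from `m × e₃ = (-e₃) × m` and `[A, ê₃] = [(-e₃)^, A]`.
  set w : Fin 3 → ℝ := (-1 : ℝ) • stdVec 2 with hw
  have hc : HasDerivAt (fun t => mk ((spin w t).1 *ᵥ m) (conjBy (spin w t) (conjBy R A₀)))
      (mk (crossProduct m (stdVec 2)) (comm (conjBy R A₀) (hat (stdVec 2)))) 0 := by
    have e1 : crossProduct m (stdVec 2) = hatR w *ᵥ m := by
      ext i
      fin_cases i <;>
        simp [hw, hatR, cross_apply, stdVec, Matrix.mulVec, dotProduct, Fin.sum_univ_three]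
    have e2 : comm (conjBy R A₀) (hat (stdVec 2)) = comm (hat w) (conjBy R A₀) := by
      rw [comm_hat_left, hw, neg_one_smul, neg_neg]
    rw [e1, e2]
    refine hasDerivAt_phase (hasDerivAt_spin_mulVec w m) fun j k => ?_
    have h := hasDerivAt_conjBy_A₀ (R := fun t => spin w t * R) (w := w)
      (by simpa [spin_zero] using hasDerivAt_spin_mul w R) j k
    simp only [spin_zero, one_mul, ← conjBy_conjBy] at h
    exact h
  refine fderiv_eq_of_curve (differentiableAt_hamiltonian hup) ?_ hc ?_
  · simp [spin_zero, conjBy_conjBy]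
  · simp only [hw, hamiltonian_conjBy _ (Gam_comm_spin _ _)]
    exact hasDerivAt_const _ _

lemma bracket_J3_jm {p : Phase} (hp : p ∈ coadjointOrbit (mk 0 A₀))
    (hu : ∀ A ∈ orbA₀, IsUnit (inertia γ₁ γ₂ γ₃ A).det) :
    bracket J3 (jm γ₁ γ₂ γ₃) p = 0 := by
  rw [bracket_jm hp hu, fderiv_J3]
  rfl

lemma gradM_hamiltonian {p : Phase} (hu : IsUnit (inertia γ₁ γ₂ γ₃ (mat p)).det) :
    gradM (hamiltonian γ₁ γ₂ γ₃) p = velocity γ₁ γ₂ γ₃ p := by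
  ext k
  have hc : HasDerivAt (fun t : ℝ => mk (vec p + t • stdVec k) (mat p)) (mk (stdVec k) 0) 0 := by
    refine hasDerivAt_phase (fun i => ?_) fun _ _ => hasDerivAt_const _ _
    change HasDerivAt (fun s : ℝ => vec p i + s * stdVec k i) _ 0
    simpa using ((hasDerivAt_id (0 : ℝ)).mul_const (stdVec k i)).const_add (vec p i)
  rw [gradM]
  refine fderiv_eq_of_curve (differentiableAt_hamiltonian hu) (by simp [mk_vec_mat]) hc ?_
  set K := (inertia γ₁ γ₂ γ₃ (mat p))⁻¹ with hK
  have hKt : Kᵀ = K := by rw [hK, Matrix.transpose_nonsing_inv, inertia_transpose]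
  have hsymm : vec p ⬝ᵥ K *ᵥ stdVec k = stdVec k ⬝ᵥ K *ᵥ vec p := by
    rw [Matrix.dotProduct_mulVec, ← Matrix.mulVec_transpose, hKt, dotProduct_comm]
  have e : ∀ t : ℝ, hamiltonian γ₁ γ₂ γ₃ (mk (vec p + t • stdVec k) (mat p)) =
      1 / 4 * (vec p ⬝ᵥ K *ᵥ vec p) + 1 / 2 * (stdVec k ⬝ᵥ K *ᵥ vec p) * t
        + 1 / 4 * (stdVec k ⬝ᵥ K *ᵥ stdVec k) * t ^ 2 := fun t => by
    simp only [hamiltonian, mat_mk, vec_mk, ← hK, Matrix.mulVec_add, Matrix.mulVec_smul,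
      dotProduct_add, add_dotProduct, smul_dotProduct, dotProduct_smul, smul_eq_mul, hsymm]
    ring
  simp only [e]
  have := ((((hasDerivAt_id (0 : ℝ)).const_mul (1 / 2 * (stdVec k ⬝ᵥ K *ᵥ vec p))).const_add
    (1 / 4 * (vec p ⬝ᵥ K *ᵥ vec p))).add
      (((hasDerivAt_id (0 : ℝ)).pow 2).const_mul (1 / 4 * (stdVec k ⬝ᵥ K *ᵥ stdVec k))))
  refine this.congr_deriv ?_
  simp [velocity, stdVec, ← hK]

end Functions

/-! ### The regular set -/

section Regular

variable (γ₁ γ₂ γ₃ : ℝ)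

/-- The points at which `n`, `e₃` and the velocity are linearly independent. -/
def regularSet : Set Phase :=
  {p | (inertia γ₁ γ₂ γ₃ (mat p)).det ≠ 0 ∧
    frame (mat p) 1 2 * velocity γ₁ γ₂ γ₃ p 0 - frame (mat p) 0 2 * velocity γ₁ γ₂ γ₃ p 1 ≠ 0}

/-- The determinant condition, automatic on the orbit, gives openness in the ambient space:
`velocity` is continuous where `J` is invertible. -/
lemma isOpen_regularSet : IsOpen (regularSet γ₁ γ₂ γ₃) := by
  rw [isOpen_iff_mem_nhds]
  rintro p ⟨hd, hv⟩
  have hdet : ContinuousAt (fun q : Phase => (inertia γ₁ γ₂ γ₃ (mat q)).det) p := by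
    have hJ : ∀ a b, ContinuousAt (fun q : Phase => inertia γ₁ γ₂ γ₃ (mat q) a b) p :=
      fun a b => (contDiffAt_inertia (n := 1) γ₁ γ₂ γ₃
        (fun j k => (contDiff_mat_apply j k).contDiffAt) a b).continuousAt
    simp only [Matrix.det_fin_three]
    fun_prop
  have hf : ∀ i j, ContinuousAt (fun q : Phase => frame (mat q) i j) p :=
    fun i j => (contDiff_frame i j).continuous.continuousAt
  have hvel : ∀ a, ContinuousAt (fun q : Phase => velocity γ₁ γ₂ γ₃ q a) p :=
    fun a => (contDiffAt_velocity (n := 1) γ₁ γ₂ γ₃ hd a).continuousAt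
  exact (hdet.eventually_ne hd).and
    ((((hf 1 2).mul (hvel 0)).sub ((hf 0 2).mul (hvel 1))).eventually_ne hv)

variable {γ₁ γ₂ γ₃}

lemma mem_regularSet_iff {m : Fin 3 → ℝ} {R : SO3}
    (hu : ∀ A ∈ orbA₀, IsUnit (inertia γ₁ γ₂ γ₃ A).det) :
    mk m (conjBy R A₀) ∈ regularSet γ₁ γ₂ γ₃ ↔
      R.1 1 2 * velocity γ₁ γ₂ γ₃ (mk m (conjBy R A₀)) 0
        - R.1 0 2 * velocity γ₁ γ₂ γ₃ (mk m (conjBy R A₀)) 1 ≠ 0 := by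
  have := (hu _ ⟨R, rfl⟩).ne_zero
  simp only [regularSet, Set.mem_ofPred_eq, mat_mk, frame_conjBy_A₀]
  exact and_iff_right this

lemma linearIndependent_diffOn {p : Phase} (hp : p ∈ coadjointOrbit (mk 0 A₀))
    (hr : p ∈ regularSet γ₁ γ₂ γ₃) (hu : ∀ A ∈ orbA₀, IsUnit (inertia γ₁ γ₂ γ₃ A).det) :
    LinearIndependent ℝ fun i => diffOn (coadjointOrbit (mk 0 A₀))
      ((![hamiltonian γ₁ γ₂ γ₃, jm γ₁ γ₂ γ₃, J3] : Fin 3 → Phase → ℝ) i) p := by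
  rw [Fintype.linearIndependent_iff]
  intro g hg
  have key : ∀ k, g 0 * gradM (hamiltonian γ₁ γ₂ γ₃) p k + g 1 * gradM (jm γ₁ γ₂ γ₃) p k
      + g 2 * gradM J3 p k = 0 := by
    intro k
    have hmem : mk (stdVec k) 0 ∈ tangentTo (coadjointOrbit (mk 0 A₀)) p := by
      rw [tangentTo_orbit hp]
      refine ⟨(stdVec k, 0), ?_⟩
      simp [tangentMap, comm, hat_zero]
    have := LinearMap.congr_fun hg ⟨_, hmem⟩
    simpa [Fin.sum_univ_three, diffOn, gradM] using this
  rw [gradM_hamiltonian (hu _ (mem_orbit_iff.mp hp)), gradM_J3] at key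
  obtain ⟨m, R, rfl⟩ := exists_eq_mk_conjBy hp
  rw [mem_regularSet_iff hu] at hr
  rw [gradM_jm m R hu] at key
  generalize velocity γ₁ γ₂ γ₃ (mk m (conjBy R A₀)) = w at *
  have k0 := key 0
  have k1 := key 1
  have k2 := key 2
  simp [director, stdVec] at k0 k1 k2
  -- Cramer's rule in the first two coordinates, where `e₃` drops out.
  have g0 : g 0 = 0 := by
    refine (mul_eq_zero.mp ?_).resolve_right hr
    linear_combination R.1 1 2 * k0 - R.1 0 2 * k1
  have g1 : g 1 = 0 := by
    refine (mul_eq_zero.mp ?_).resolve_right hr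
    linear_combination w 1 * k0 - w 0 * k1
  have g2 : g 2 = 0 := by
    rw [g0, g1] at k2; linarith
  intro i
  fin_cases i <;> assumption

/-! ### Density of the regular set -/

lemma mem_closure_of_curve {s : Set Phase} {c : ℝ → Phase} (hc : Continuous c)
    (hs : ∀ t ≠ 0, c t ∈ s) : c 0 ∈ closure s := by
  refine mem_closure_of_tendsto (b := nhdsWithin (0 : ℝ) {0}ᶜ) (f := c)
    ((hc.tendsto 0).mono_left nhdsWithin_le_nhds) ?_
  filter_upwards [self_mem_nhdsWithin] with t ht using hs t ht

lemma mem_closure_regularSet_of_director (m : Fin 3 → ℝ) (R : SO3)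
    (hu : ∀ A ∈ orbA₀, IsUnit (inertia γ₁ γ₂ γ₃ A).det) (hn : R.1 0 2 ≠ 0 ∨ R.1 1 2 ≠ 0) :
    mk m (conjBy R A₀) ∈ closure (coadjointOrbit (mk 0 A₀) ∩ regularSet γ₁ γ₂ γ₃) := by
  by_cases hr : mk m (conjBy R A₀) ∈ regularSet γ₁ γ₂ γ₃
  · exact subset_closure ⟨mk_mem_orbit m R, hr⟩
  rw [mem_regularSet_iff hu, not_not] at hr
  set A := conjBy R A₀ with hA
  have huA := hu A ⟨R, rfl⟩
  set w := velocity γ₁ γ₂ γ₃ (mk m A) with hw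
  -- `x = n × e₃`; moving `w` by `t x` at fixed `A` makes the determinant `t (n₀² + n₁²)`.
  set x : Fin 3 → ℝ := ![R.1 1 2, -R.1 0 2, 0]
  let c : ℝ → Phase := fun t => mk ((2 : ℝ) • inertia γ₁ γ₂ γ₃ A *ᵥ (w + t • x)) A
  have hc0 : c 0 = mk m A := by
    have := inertia_mulVec_velocity γ₁ γ₂ γ₃ (p := mk m A) huA
    simp only [c, zero_smul, add_zero]
    rw [mat_mk] at this
    rw [hw, this, smul_smul]
    norm_num [vec_mk]
  have hc : Continuous c := by
    suffices h : ContDiff ℝ 0 c from h.continuous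
    refine contDiff_phase (fun i => ?_) fun _ _ => contDiff_const
    change ContDiff ℝ 0 fun t : ℝ => (2 : ℝ) * (inertia γ₁ γ₂ γ₃ A *ᵥ (w + t • x)) i
    simp only [Matrix.mulVec, dotProduct, Pi.add_apply, Pi.smul_apply, smul_eq_mul]
    fun_prop
  rw [← hc0]
  refine mem_closure_of_curve hc fun t ht => ⟨mk_mem_orbit _ _, ?_⟩
  simp only [c]
  rw [hA, mem_regularSet_iff hu, ← hA, velocity_of_inertia_mulVec _ _ _ huA]
  have e : R.1 1 2 * (w + t • x) 0 - R.1 0 2 * (w + t • x) 1 =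
      t * (R.1 1 2 ^ 2 + R.1 0 2 ^ 2) := by
    simp [x]
    linear_combination hr
  rw [e]
  refine mul_ne_zero ht (ne_of_gt ?_)
  rcases hn with h | h <;> positivity

lemma orbit_subset_closure (hu : ∀ A ∈ orbA₀, IsUnit (inertia γ₁ γ₂ γ₃ A).det) :
    coadjointOrbit (mk 0 A₀) ⊆ closure (coadjointOrbit (mk 0 A₀) ∩ regularSet γ₁ γ₂ γ₃) := by
  intro p hp
  obtain ⟨m, R, rfl⟩ := exists_eq_mk_conjBy hp
  by_cases hn : R.1 0 2 ≠ 0 ∨ R.1 1 2 ≠ 0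
  · exact mem_closure_regularSet_of_director m R hu hn
  push Not at hn
  obtain ⟨hn0, hn1⟩ := hn
  -- Here `n = ± e₃`. Rotating about the body axis `u` tilts `n` towards `-v`, which is horizontal.
  let Q : ℝ → SO3 := fun t => R * spin (stdVec 0) t
  have hQ : ∀ t i, R.1 i 2 = 0 → (Q t).1 i 2 = -((1 + 1 / 4 * t ^ 2)⁻¹ * t * R.1 i 1) := by
    intro t i hi
    change (R.1 * (spin (stdVec 0) t).1) i 2 = _
    rw [Matrix.mul_apply, Fin.sum_univ_three, hi]
    simp [spin, spinMatrix, hatR, stdVec]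
    ring
  have hc : Continuous fun t => mk m (conjBy (Q t) A₀) := by
    suffices h : ContDiff ℝ ∞ fun t => mk m (conjBy (Q t) A₀) from h.continuous
    exact contDiff_phase (fun _ => contDiff_const) (contDiff_conjBy_A₀
      (contDiff_SO3_mul (fun _ _ => contDiff_const) (contDiff_spin _)))
  have h0 : Q 0 = R := by simp [Q, spin_zero]
  rw [← closure_closure]
  have := mem_closure_of_curve hc (s := closure (coadjointOrbit (mk 0 A₀) ∩ regularSet γ₁ γ₂ γ₃))
    fun t ht => mem_closure_regularSet_of_director m (Q t) hu ?_
  · simpa only [h0] using this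
  · have hpos : (1 + 1 / 4 * t ^ 2)⁻¹ * t ≠ 0 := mul_ne_zero (by positivity) ht
    rw [hQ t 0 hn0, hQ t 1 hn1, neg_ne_zero, neg_ne_zero]
    -- Otherwise the first two rows of `R` would both be multiples of `(1, 0, 0)`, contradicting
    -- orthonormality.
    by_contra hcon
    push Not at hcon
    have z0 := (mul_eq_zero.mp hcon.1).resolve_left hpos
    have z1 := (mul_eq_zero.mp hcon.2).resolve_left hpos
    have r00 := R.rows 0 0
    have r11 := R.rows 1 1
    have r01 := R.rows 0 1
    simp [hn0, hn1, z0, z1] at r00 r11 r01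
    rcases r01 with h | h <;> simp [h] at r00 r11

/-! ### Euler angles and the singular set -/

/-- The rotation by the angle `t` about the second axis. -/
def rotY (t : ℝ) : SO3 :=
  ⟨!![Real.cos t, 0, Real.sin t; 0, 1, 0; -Real.sin t, 0, Real.cos t], mem_SO3
    (by
      have := Real.sin_sq_add_cos_sq t
      ext i j
      fin_cases i <;> fin_cases j <;>
        simp [Matrix.mul_apply, Fin.sum_univ_three] <;> nlinarith)
    (by
      have := Real.sin_sq_add_cos_sq t
      simp [Matrix.det_fin_three]; nlinarith)⟩

lemma exists_polar (x y : ℝ) :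
    ∃ t, x = √(x ^ 2 + y ^ 2) * Real.cos t ∧ y = √(x ^ 2 + y ^ 2) * Real.sin t := by
  have e : ‖(⟨x, y⟩ : ℂ)‖ = √(x ^ 2 + y ^ 2) := by
    rw [Complex.norm_eq_sqrt_sq_add_sq]
  refine ⟨Complex.arg ⟨x, y⟩, ?_, ?_⟩
  · rw [← e, Complex.norm_mul_cos_arg]
  · rw [← e, Complex.norm_mul_sin_arg]

lemma exists_eq_rotZ {Q : SO3} (h0 : Q.1 0 2 = 0) (h1 : Q.1 1 2 = 0) (h2 : Q.1 2 2 = 1) :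
    ∃ t, Q = rotZ t := by
  obtain ⟨⟨c00, c01, -⟩, -⟩ := Q.cofactors
  have r22 := Q.rows 2 2
  have r00 := Q.rows 0 0
  simp only [h0, h1, h2, if_true] at c00 c01 r22 r00
  have z0 : Q.1 2 0 = 0 := by nlinarith [mul_self_nonneg (Q.1 2 0), mul_self_nonneg (Q.1 2 1)]
  have z1 : Q.1 2 1 = 0 := by nlinarith [mul_self_nonneg (Q.1 2 0), mul_self_nonneg (Q.1 2 1)]
  obtain ⟨t, hx, hy⟩ := exists_polar (Q.1 0 0) (Q.1 1 0)
  have e : Q.1 0 0 ^ 2 + Q.1 1 0 ^ 2 = 1 := by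
    rw [c01] at r00
    linear_combination r00
  rw [e, Real.sqrt_one, one_mul] at hx hy
  refine ⟨t, ?_⟩
  ext i j
  fin_cases i <;> fin_cases j <;> simp [rotZ, h0, h1, h2, z0, z1] <;> linarith

/-- Euler angles. -/
lemma exists_euler (R : SO3) : ∃ a b c, R = rotZ a * rotY b * rotZ c ∧
    (R.1 0 2 = 0 → R.1 1 2 = 0 → Real.sin b = 0) := by
  -- `a` and `b` are the azimuth and the polar angle of the director, so `(rotZ a * rotY b)⁻¹ R`
  -- fixes `e₃`.
  obtain ⟨a, ha0, ha1⟩ := exists_polar (R.1 0 2) (R.1 1 2)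
  obtain ⟨b, hb0, hb1⟩ := exists_polar (R.1 2 2) √(R.1 0 2 ^ 2 + R.1 1 2 ^ 2)
  have hcol := R.cols 2 2
  have e : R.1 2 2 ^ 2 + √(R.1 0 2 ^ 2 + R.1 1 2 ^ 2) ^ 2 = 1 := by
    rw [Real.sq_sqrt (by positivity)]
    simp only [if_true] at hcol
    linear_combination hcol
  rw [e, Real.sqrt_one, one_mul] at hb0 hb1
  rw [hb1] at ha0 ha1
  set P := rotZ a * rotY b with hP
  have hPR : ∀ i, R.1 i 2 = P.1 i 2 := by
    intro i
    change _ = ((rotZ a).1 * (rotY b).1) i 2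
    rw [Matrix.mul_apply, Fin.sum_univ_three]
    fin_cases i
    · simp [rotZ, rotY]; linarith
    · simp [rotZ, rotY]; linarith
    · simp [rotZ, rotY]; linarith
  have hQ : ∀ i, (P.symm * R).1 i 2 = if i = 2 then 1 else 0 := by
    intro i
    change (P.1ᵀ * R.1) i 2 = _
    rw [Matrix.mul_apply, Fin.sum_univ_three, hPR, hPR, hPR, ← P.cols i 2]
    simp
  obtain ⟨c, hc⟩ := exists_eq_rotZ (Q := P.symm * R) (by simp [hQ]) (by simp [hQ]) (by simp [hQ])
  refine ⟨a, b, c, ?_, fun h0 h1 => ?_⟩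
  · rw [← hP, ← hc]
    refine Subtype.ext ?_
    change R.1 = P.1 * (P.1ᵀ * R.1)
    rw [← mul_assoc, P.mul_transpose, one_mul]
  · rw [← hb1, h0, h1]; simp

lemma contDiff_rotZ {E : Type*} [NormedAddCommGroup E] [NormedSpace ℝ E] {n : WithTop ℕ∞}
    {f : E → ℝ} (hf : ContDiff ℝ n f) (i j : Fin 3) :
    ContDiff ℝ n fun x => (rotZ (f x)).1 i j := by
  have hs := Real.contDiff_sin.comp hf
  have hc := Real.contDiff_cos.comp hf
  fin_cases i <;> fin_cases j <;> simp [rotZ] <;>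
    first
      | exact contDiff_const
      | exact hc
      | exact hs
      | exact hs.neg

lemma contDiff_rotY {E : Type*} [NormedAddCommGroup E] [NormedSpace ℝ E] {n : WithTop ℕ∞}
    {f : E → ℝ} (hf : ContDiff ℝ n f) (i j : Fin 3) :
    ContDiff ℝ n fun x => (rotY (f x)).1 i j := by
  have hs := Real.contDiff_sin.comp hf
  have hc := Real.contDiff_cos.comp hf
  fin_cases i <;> fin_cases j <;> simp [rotY] <;>
    first
      | exact contDiff_const
      | exact hc
      | exact hs
      | exact hs.neg

/-- Points of the orbit with `n = ± e₃`. -/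
def polarPoint (b : ℝ) (x : Fin 5 → ℝ) : Phase :=
  mk ![x 0, x 1, x 2] (conjBy (rotZ (x 3) * rotY b * rotZ (x 4)) A₀)

lemma contDiff_polarPoint (b : ℝ) : ContDiff ℝ 1 (polarPoint b) := by
  refine contDiff_phase (fun i => ?_) (contDiff_conjBy_A₀ (contDiff_SO3_mul
    (contDiff_SO3_mul (contDiff_rotZ (by fun_prop)) fun _ _ => contDiff_const)
    (contDiff_rotZ (by fun_prop))))
  fin_cases i <;> simp [polarPoint, vec_mk] <;> fun_prop

variable (γ₁ γ₂ γ₃) in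
/-- Points of the orbit whose velocity is a combination of `n` and `e₃`. -/
def coplanarPoint (x : Fin 5 → ℝ) : Phase :=
  let R := rotZ (x 0) * rotY (x 1) * rotZ (x 2)
  mk ((2 : ℝ) • inertia γ₁ γ₂ γ₃ (conjBy R A₀) *ᵥ (x 3 • director R + x 4 • stdVec 2))
    (conjBy R A₀)

lemma contDiff_coplanarPoint : ContDiff ℝ 1 (coplanarPoint γ₁ γ₂ γ₃) := by
  have hR : ∀ i j, ContDiff ℝ 1 fun x : Fin 5 → ℝ =>
      (rotZ (x 0) * rotY (x 1) * rotZ (x 2)).1 i j :=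
    contDiff_SO3_mul (contDiff_SO3_mul (contDiff_rotZ (by fun_prop)) (contDiff_rotY (by fun_prop)))
      (contDiff_rotZ (by fun_prop))
  refine contDiff_phase (fun i => ?_) (contDiff_conjBy_A₀ hR)
  simp only [coplanarPoint, vec_mk, Pi.smul_apply, smul_eq_mul, Matrix.mulVec, dotProduct,
    Pi.add_apply, director]
  refine contDiff_const.mul (ContDiff.sum fun a _ => ContDiff.mul ?_ ?_)
  · exact contDiff_iff_contDiffAt.mpr fun x => contDiffAt_inertia _ _ _
      (fun j k => (contDiff_conjBy_A₀ hR j k).contDiffAt) i a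
  · exact (ContDiff.mul (by fun_prop) (hR a 2)).add (ContDiff.mul (by fun_prop) contDiff_const)

lemma exists_coplanar {n w : Fin 3 → ℝ} (hn : n 0 ≠ 0 ∨ n 1 ≠ 0)
    (h : n 1 * w 0 - n 0 * w 1 = 0) : ∃ s t : ℝ, w = s • n + t • stdVec 2 := by
  have hpos : n 0 ^ 2 + n 1 ^ 2 ≠ 0 := by
    refine ne_of_gt ?_
    rcases hn with h | h <;> positivity
  refine ⟨(w 0 * n 0 + w 1 * n 1) / (n 0 ^ 2 + n 1 ^ 2),
    w 2 - (w 0 * n 0 + w 1 * n 1) / (n 0 ^ 2 + n 1 ^ 2) * n 2, ?_⟩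
  ext i
  fin_cases i <;> simp [stdVec] <;> field_simp
  · linear_combination n 1 * h
  · linear_combination -n 0 * h

/-- If `n ≠ ± e₃`, then `w = s n + t e₃` and `m = 2 J w` is recovered from three Euler angles and
`s, t`. If `n = ± e₃`, the middle angle may be fixed at `0` or `π`, leaving `m` and two angles. -/
lemma orbit_diff_regularSet_subset (hu : ∀ A ∈ orbA₀, IsUnit (inertia γ₁ γ₂ γ₃ A).det) :
    coadjointOrbit (mk 0 A₀) \ regularSet γ₁ γ₂ γ₃ ⊆ Set.range (coplanarPoint γ₁ γ₂ γ₃) ∪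
      (Set.range (polarPoint 0) ∪ Set.range (polarPoint Real.pi)) := by
  rintro p ⟨hp, hr⟩
  obtain ⟨m, R, rfl⟩ := exists_eq_mk_conjBy hp
  rw [mem_regularSet_iff hu, not_not] at hr
  obtain ⟨a, b, c, hR, hb⟩ := exists_euler R
  by_cases hn : R.1 0 2 ≠ 0 ∨ R.1 1 2 ≠ 0
  · obtain ⟨s, t, hst⟩ := exists_coplanar (n := director R) hn hr
    refine Or.inl ⟨![a, b, c, s, t], ?_⟩
    have hv := inertia_mulVec_velocity γ₁ γ₂ γ₃ (p := mk m (conjBy R A₀)) (hu _ ⟨R, rfl⟩)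
    rw [hst, mat_mk, vec_mk] at hv
    change mk ((2 : ℝ) • inertia γ₁ γ₂ γ₃ (conjBy (rotZ a * rotY b * rotZ c) A₀) *ᵥ
      (s • director (rotZ a * rotY b * rotZ c) + t • stdVec 2))
      (conjBy (rotZ a * rotY b * rotZ c) A₀) = _
    rw [← hR, hv, smul_smul]
    norm_num
  · push Not at hn
    have hs := hb hn.1 hn.2
    have hm : ![m 0, m 1, m 2] = m := by ext i; fin_cases i <;> rfl
    have hpt : ∀ b', rotY b = rotY b' →
        polarPoint b' ![m 0, m 1, m 2, a, c] = mk m (conjBy R A₀) := by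
      intro b' hb'
      rw [hR, hb']
      change mk ![m 0, m 1, m 2] _ = _
      rw [hm]
      rfl
    rcases Real.sin_eq_zero_iff_cos_eq.mp hs with hc | hc
    · refine Or.inr (Or.inl ⟨_, hpt 0 ?_⟩)
      ext i j; simp [rotY, hs, hc]
    · refine Or.inr (Or.inr ⟨_, hpt Real.pi ?_⟩)
      ext i j; simp [rotY, hs, hc]

lemma hausdorffMeasure_orbit_diff_regularSet
    (hu : ∀ A ∈ orbA₀, IsUnit (inertia γ₁ γ₂ γ₃ A).det) :
    MeasureTheory.Measure.hausdorffMeasure 6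
      (coadjointOrbit (mk 0 A₀) \ regularSet γ₁ γ₂ γ₃) = 0 := by
  have h5 : ∀ {f : (Fin 5 → ℝ) → Phase}, ContDiff ℝ 1 f → dimH (Set.range f) ≤ 5 := fun hf => by
    simpa using hf.dimH_range_le
  have h : dimH (coadjointOrbit (mk 0 A₀) \ regularSet γ₁ γ₂ γ₃) < ((6 : NNReal) : ENNReal) := by
    refine (dimH_mono (orbit_diff_regularSet_subset hu)).trans_lt ?_
    rw [dimH_union, dimH_union]
    refine (max_le (h5 contDiff_coplanarPoint) (max_le (h5 (contDiff_polarPoint _))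
      (h5 (contDiff_polarPoint _)))).trans_lt ?_
    norm_num
  simpa using hausdorffMeasure_of_dimH_lt h

end Regular

end APhase

end

theorem theorem4p7 (γ₁ γ₂ γ₃ : ℝ) (hγ₁ : 0 < γ₁) (hγ₂ : 0 < γ₂) (hγ₃ : 0 < γ₃) :
    coadjointOrbit (mk 0 A₀) = {p | mat p ∈ orbA₀} ∧
    (∀ A ∈ orbA₀, IsUnit (inertia γ₁ γ₂ γ₃ A).det) ∧
    ((∀ φ : ℝ, ∀ A ∈ orbA₀, Complex.exp (φ * Complex.I) • A ∈ orbA₀) ∧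
      ∀ p ∈ coadjointOrbit (mk 0 A₀), ∀ ψ : Phase →L[ℝ] ℝ,
        bracket ψ (jm γ₁ γ₂ γ₃) p = ψ (mk 0 (Complex.I • mat p))) ∧
    IsCompletelyIntegrableOn (coadjointOrbit (mk 0 A₀)) 3
      ![hamiltonian γ₁ γ₂ γ₃, jm γ₁ γ₂ γ₃, J3] := by
  have hu : ∀ A ∈ orbA₀, IsUnit (inertia γ₁ γ₂ γ₃ A).det := fun A hA =>
    isUnit_det_inertia hγ₁ hγ₂.le hγ₃.le hA
  refine ⟨coadjointOrbit_eq, hu, ⟨fun φ A hA => exp_smul_mem_orbA₀ φ hA, fun p hp ψ => ?_⟩, ?_⟩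
  · rw [bracket_jm hp hu, ψ.fderiv]
  constructor
  · exact fun p hp => finrank_tangentTo_orbit hp
  · exact fun p hp φ h v hv => bracket_nondegenerate hp φ h hv
  · intro i p hp
    have hd := (hu _ (mem_orbit_iff.mp hp)).ne_zero
    fin_cases i
    · exact contDiffAt_hamiltonian γ₁ γ₂ γ₃ hd
    · exact contDiffAt_jm γ₁ γ₂ γ₃ hd
    · exact contDiff_J3.contDiffAt
  · intro i j p hp
    have h1 := bracket_hamiltonian_jm hp hu
    have h2 := bracket_J3_hamiltonian hp hu
    have h3 := bracket_J3_jm hp hu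
    fin_cases i <;> fin_cases j
    · exact bracket_self _ p
    · exact h1
    · exact (bracket_swap _ _ p).trans (neg_eq_zero.mpr h2)
    · exact (bracket_swap _ _ p).trans (neg_eq_zero.mpr h1)
    · exact bracket_self _ p
    · exact (bracket_swap _ _ p).trans (neg_eq_zero.mpr h3)
    · exact h2
    · exact h3
    · exact bracket_self _ p
  · refine ⟨regularSet γ₁ γ₂ γ₃, isOpen_regularSet γ₁ γ₂ γ₃, orbit_subset_closure hu, ?_,
      fun p hp => linearIndependent_diffOn hp.1 hp.2 hu⟩
    have h := hausdorffMeasure_orbit_diff_regularSet hu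
    have e : (2 * ((3 : ℕ) : ℝ)) = 6 := by norm_num
    rwa [e]
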